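/- Let $X$ be a projective variety over $\mathbb C$ (integral, with a closed immersion into some $\mathbb P^N$), let $L$ be a line bundle on $X$ with a smooth Hermitian metric $\|\cdot\|$ and Chern form $c_1(L,\|\cdot\|)=-2\,\mathrm{dd^c}\log\|e\|$ for local frames $e$, where $\mathrm{dd^c}=\frac{i}{2\pi}\partial\bar\partial$. Write $\mathbb D_t=\{z\in\mathbb C:|z|<t\}$ and $\mathbb D_{+\infty}=\mathbb C$. For a holomorphic map $f\colon\mathbb D_R\to X$, for an effective Cartier divisor $D$ with $f(\mathbb D_R)\not\subseteq D$ given by a nonzero section $s_D\in\Gamma(X,L)$, and for a closed subscheme $Z\subseteq X$ with $f(\mathbb D_R)\not\subseteq Z$, put $$T(r,f,L,\|\cdot\|)=\int_1^r\Big(\int_{\mathbb D_t}f^*c_1(L,\|\cdot\|)\Big)\frac{dt}{t},\qquad m(r,f,D,\|\cdot\|)=-\int_0^{2\pi}\log\|s_D(f(re^{i\theta}))\|\frac{d\theta}{2\pi},$$ $$N(r,f,Z)=\int_1^r\Big(\sum_{z\in\mathbb D_t}\mathrm{ord}_zf^*Z\Big)\frac{dt}{t},$$ where $\mathrm{ord}_zf^*Z$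 is the minimum of the vanishing orders at $z$ of the functions $g\circ f$, for $g$ in the ideal of $Z$ near $f(z)$ (equivalently, $\min_i\mathrm{ord}_zf^*D_i$ if $Z=D_1\cap\dots\cap D_l$ with effective Cartier divisors $D_i$). Let $(R_n)_{n\ge1}$ be an increasing sequence in $(0,+\infty]$ with limit $R_\infty$, and let $f_n\colon\mathbb D_{R_n}\to X$ $(1\le n\le\infty)$ be holomorphic maps such that $f_n$ converges to $f_\infty$ uniformly on every compact subset of $\mathbb D_{R_\infty}$. Let $0<r<R_\infty$. 1. If $R_\infty>1$, then $T(r,f_n,L,\|\cdot\|)\to T(r,f_\infty,L,\|\cdot\|)$ as $n\to\infty$. 2. Let $D$ be an effective Cartier divisor given by a nonzero section $s_D\in\Gamma(X,L)$. If $f_\infty(z)\notin D$ for all $z$ with $|z|=r$, then $f_n(\mathbb D_{R_n})\not\subseteq D$ for $n$ large, $m(r,f_n,D,\|\cdot\|)\to m(r,f_\infty,D,\|\cdot\|)$, and, if $R_\infty>1$, $N(r,f_n,D)\to N(r,f_\infty,D)$. 3. Let $Z\subseteq X$ be any closed subscheme (of codimension possibly greater than $1$) with $f_\infty(\mathbb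 D_{R_\infty})\not\subseteq Z$, and let $r\ge1$. Assume that $f_\infty(z)\notin Z$ for all $z$ with $|z|=r$, or that $f_\infty(z)\in Z$ for some $z$ with $|z|<r$. Then, for all $n$ large enough (depending on $r$), $f_n(\mathbb D_{R_n})\not\subseteq Z$ and $N(r,f_n,Z)\le2N(r,f_\infty,Z)$. -/

import Mathlib

open AlgebraicGeometry CategoryTheory Filter Topology MeasureTheory
open scoped ENNReal ContDiff

namespace Nevanlinna

attribute [local instance] MvPolynomial.gradedAlgebra

/-- The structure morphism `ℙᴺ → Spec ℂ` of complex projective space `ℙᴺ = Proj ℂ[x₀, …, x_N]`. -/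
noncomputable def projectiveSpaceToSpec (N : ℕ) :
    Proj (MvPolynomial.homogeneousSubmodule (Fin (N + 1)) ℂ) ⟶ Spec (CommRingCat.of ℂ) :=
  Proj.toSpecZero (MvPolynomial.homogeneousSubmodule (Fin (N + 1)) ℂ) ≫
    Spec.map (CommRingCat.ofHom
      (algebraMap ℂ (MvPolynomial.homogeneousSubmodule (Fin (N + 1)) ℂ 0)))

/-- A projective variety over `ℂ`: an integral scheme over `ℂ` that admits a closed immersion
over `ℂ` into some projective space. -/
structure IsProjectiveVariety (X : Scheme.{0}) [X.Over (Spec (CommRingCat.of ℂ))] : Prop where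
  isIntegral : IsIntegral X
  exists_closedImmersion : ∃ (N : ℕ)
    (i : X ⟶ Proj (MvPolynomial.homogeneousSubmodule (Fin (N + 1)) ℂ)),
      IsClosedImmersion i ∧ i ≫ projectiveSpaceToSpec N = X ↘ Spec (CommRingCat.of ℂ)

/-- The set `X(ℂ)` of complex points of a scheme `X` over `ℂ`. -/
structure CPoint (X : Scheme.{0}) [X.Over (Spec (CommRingCat.of ℂ))] where
  hom : Spec (CommRingCat.of ℂ) ⟶ X
  hom_comp : hom ≫ (X ↘ Spec (CommRingCat.of ℂ)) = 𝟙 (Spec (CommRingCat.of ℂ))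

section

variable {X : Scheme.{0}} [X.Over (Spec (CommRingCat.of ℂ))]

/-- The point of the underlying topological space of `X` given by a complex point. -/
noncomputable def CPoint.pt (x : CPoint X) : X := x.hom (IsLocalRing.closedPoint ℂ)

theorem CPoint.le_preimage (x : CPoint X) {U : X.Opens} (hx : x.pt ∈ U) :
    (⊤ : (Spec (CommRingCat.of ℂ)).Opens) ≤ x.hom ⁻¹ᵁ U := by
  intro y _
  have hy : y = IsLocalRing.closedPoint ℂ :=
    Subsingleton.elim (α := PrimeSpectrum ℂ) y (IsLocalRing.closedPoint ℂ)
  subst hy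
  exact hx

open Classical in
/-- The value `g(x) ∈ ℂ` of a regular function `g` on a Zariski open `U` at a complex point `x` of
`U` (and `0` if `x` is not in `U`). -/
noncomputable def evalAt (U : X.Opens) (g : Γ(X, U)) (x : CPoint X) : ℂ :=
  if hx : x.pt ∈ U then
    (Scheme.ΓSpecIso (CommRingCat.of ℂ)).hom (x.hom.appLE U ⊤ (x.le_preimage hx) g)
  else 0

variable (X) in
/-- The Euclidean topology of `X(ℂ)`: the coarsest topology for which every Zariski open subset is
open and every regular function on a Zariski open subset is continuous there. -/
@[reducible] def euclideanTopology : TopologicalSpace (CPoint X) :=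
  TopologicalSpace.generateFrom
    {S | ∃ (U : X.Opens) (g : Γ(X, U)) (W : Set ℂ), IsOpen W ∧
      S = {x | x.pt ∈ U ∧ evalAt U g x ∈ W}}

instance : TopologicalSpace (CPoint X) := euclideanTopology X

/-- The open disc of radius `R ∈ (0, ∞]` about `0`; it is `ℂ` for `R = ∞`. -/
def disc (R : ℝ≥0∞) : Set ℂ := Metric.eball 0 R

/-- A map from an open set `S ⊆ ℂ` to the complex analytic space `X(ℂ)` is holomorphic if it is
continuous and pulls regular functions on Zariski opens back to holomorphic functions.
(Only the values of `f` on `S` matter.) -/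
def IsHolomorphicOn (f : ℂ → CPoint X) (S : Set ℂ) : Prop :=
  ContinuousOn f S ∧ ∀ (U : X.Opens) (g : Γ(X, U)),
    DifferentiableOn ℂ (fun z ↦ evalAt U g (f z)) {z | z ∈ S ∧ (f z).pt ∈ U}

/-- A real function on the (possibly singular) space `X(ℂ)` is smooth at `x` if near `x` it is a
`C^∞` function of finitely many regular functions, that is, the restriction of a smooth function
through a local embedding into an affine space. -/
def SmoothAt (φ : CPoint X → ℝ) (x : CPoint X) : Prop :=
  ∃ (U : X.Opens) (k : ℕ) (g : Fin k → Γ(X, U)) (Φ : (Fin k → ℂ) → ℝ),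
    x.pt ∈ U ∧ ContDiff ℝ ∞ Φ ∧ ∀ᶠ y in 𝓝 x, φ y = Φ (fun i ↦ evalAt U (g i) y)

/-- The restriction of a section of a sheaf of modules to a smaller open. -/
noncomputable def res (M : X.Modules) {V U : X.Opens} (h : V ≤ U) (s : Γ(M, U)) : Γ(M, V) :=
  M.presheaf.map (homOfLE h).op s

/-- A section `e` over `U` is a frame (a nowhere vanishing section of a line bundle) if
multiplication with `e` is an isomorphism from `𝒪` to `M` over `U`. -/
def IsFrame (M : X.Modules) {U : X.Opens} (e : Γ(M, U)) : Prop :=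
  ∀ (V : X.Opens) (h : V ≤ U), Function.Bijective (fun g : Γ(X, V) ↦ g • res M h e)

variable (X) in
/-- A line bundle: a sheaf of modules that is locally isomorphic to the structure sheaf. -/
structure LineBundle where
  sheaf : X.Modules
  exists_frame : ∀ x : X, ∃ (U : X.Opens) (e : Γ(sheaf, U)), x ∈ U ∧ IsFrame sheaf e

/-- A smooth Hermitian metric on a line bundle `L`, given by the pointwise norms `‖s(x)‖` of the
sections `s` of `L` over `U` at the complex points `x` of `U` (`norm U s x` is irrelevant for `x`
outside `U`). -/
structure HermitianMetric (L : LineBundle X) where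
  norm : (U : X.Opens) → Γ(L.sheaf, U) → CPoint X → ℝ
  norm_res : ∀ {V U : X.Opens} (h : V ≤ U) (s : Γ(L.sheaf, U)) (x : CPoint X), x.pt ∈ V →
    norm V (res L.sheaf h s) x = norm U s x
  norm_smul : ∀ {U : X.Opens} (g : Γ(X, U)) (s : Γ(L.sheaf, U)) (x : CPoint X), x.pt ∈ U →
    norm U (g • s) x = ‖evalAt U g x‖ * norm U s x
  norm_pos : ∀ {U : X.Opens} (e : Γ(L.sheaf, U)), IsFrame L.sheaf e →
    ∀ x : CPoint X, x.pt ∈ U → 0 < norm U e x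
  smooth : ∀ {U : X.Opens} (e : Γ(L.sheaf, U)), IsFrame L.sheaf e →
    ∀ x : CPoint X, x.pt ∈ U → SmoothAt (fun y ↦ norm U e y ^ 2) x

/-- The density, with respect to Lebesgue measure `dx dy`, of the pullback `f^* c₁(L, ‖·‖)` of the
Chern form. With a frame `e` of `L` near `f z`, one has
`f^* c₁(L, ‖·‖) = -2 dd^c log ‖e ∘ f‖ = -(1 / 2π) Δ (log ‖e ∘ f‖) dx dy`,
and this does not depend on the frame. -/
noncomputable def chernDensity {L : LineBundle X} (h : HermitianMetric L) (f : ℂ → CPoint X)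
    (z : ℂ) : ℝ :=
  -(1 / (2 * Real.pi)) *
    Laplacian.laplacian (fun w : ℂ ↦
      Real.log (h.norm (L.exists_frame (f z).pt).choose
        (L.exists_frame (f z).pt).choose_spec.choose (f w))) z

/-- The characteristic function
`T(r, f, L, ‖·‖) = ∫_1^r (∫_{|z| < t} f^* c₁(L, ‖·‖)) dt / t`. -/
noncomputable def characteristic {L : LineBundle X} (h : HermitianMetric L) (f : ℂ → CPoint X)
    (r : ℝ) : ℝ :=
  ∫ t in (1 : ℝ)..r, (∫ z in Metric.ball (0 : ℂ) t, chernDensity h f z) / t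

/-- The proximity function `m(r, f, D, ‖·‖) = -∫_0^{2π} log ‖s(f(r e^{iθ}))‖ dθ / 2π` of the
divisor `D` of a global section `s`. -/
noncomputable def proximity {L : LineBundle X} (h : HermitianMetric L) (s : Γ(L.sheaf, ⊤))
    (f : ℂ → CPoint X) (r : ℝ) : ℝ :=
  -Real.circleAverage (fun z ↦ Real.log (h.norm ⊤ s (f z))) 0 r

/-- `D` is the closed subscheme of zeros of the global section `s` of `L`: its ideal is generated
by the local equations `g = s / e` of `s`, for all frames `e`. For `s ≠ 0` on an integral scheme this
is the effective Cartier divisor associated to `s`. -/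
def IsDivisorOf (L : LineBundle X) (s : Γ(L.sheaf, ⊤)) (D : X.IdealSheafData) : Prop :=
  ∀ (U : X.affineOpens) (e : Γ(L.sheaf, U.1)), IsFrame L.sheaf e →
    ∀ g : Γ(X, U.1), g • e = res L.sheaf le_top s → D.ideal U = Ideal.span {g}

/-- `ord_z f^* Z`, for the closed subscheme `Z` with the given ideal sheaf: the least vanishing
order at `z` of the functions `g ∘ f`, for `g` in the ideal of `Z` on an affine neighbourhood of
`f z`. It is `∞` if `f` maps a neighbourhood of `z` into `Z`. -/
noncomputable def orderAt (Z : X.IdealSheafData) (f : ℂ → CPoint X) (z : ℂ) : ℕ∞ :=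
  ⨅ (U : X.affineOpens) (_ : (f z).pt ∈ U.1) (g : Γ(X, U.1)) (_ : g ∈ Z.ideal U),
    analyticOrderAt (fun w ↦ evalAt U.1 g (f w)) z

theorem evalAt_add (U : X.Opens) (g h : Γ(X, U)) (x : CPoint X) :
    evalAt U (g + h) x = evalAt U g x + evalAt U h x := by
  unfold evalAt; split_ifs <;> simp
theorem evalAt_mul (U : X.Opens) (g h : Γ(X, U)) (x : CPoint X) :
    evalAt U (g * h) x = evalAt U g x * evalAt U h x := by
  unfold evalAt; split_ifs <;> simp
theorem evalAt_zero (U : X.Opens) (x : CPoint X) :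
    evalAt U (0 : Γ(X, U)) x = 0 := by
  unfold evalAt; split_ifs <;> simp
theorem evalAt_res {U V : X.Opens} (h : V ≤ U) (g : Γ(X, U)) (x : CPoint X) (hx : x.pt ∈ V) :
    evalAt V (X.presheaf.map (homOfLE h).op g) x = evalAt U g x := by
  unfold evalAt
  rw [dif_pos hx, dif_pos (h hx)]
  congr 1
  rw [← CommRingCat.comp_apply, Scheme.Hom.map_appLE]

/-- For `Z` the intersection of closed subschemes `D i` (so that its ideal is the sum of their ideals),
`ord_z f^* Z` is the least of the `ord_z f^* (D i)`. -/
theorem orderAt_iSup {ι : Type} (D : ι → X.IdealSheafData)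
    (f : ℂ → CPoint X) (z : ℂ) : orderAt (⨆ i, D i) f z = ⨅ i, orderAt (D i) f z := by
  apply le_antisymm
  · refine le_iInf fun i ↦ le_iInf₂ fun U hU ↦ le_iInf₂ fun g hg ↦ ?_
    refine iInf₂_le_of_le U hU (iInf₂_le_of_le g ?_ le_rfl)
    have : D i ≤ ⨆ i, D i := le_iSup D i
    exact this U hg
  · refine le_iInf₂ fun U hU ↦ le_iInf₂ fun g hg ↦ ?_
    rw [Scheme.IdealSheafData.ideal_iSup, iSup_apply] at hg
    induction hg using Submodule.iSup_induction' with
    | mem i x hx => exact iInf_le_of_le i (iInf₂_le_of_le U hU (iInf₂_le_of_le x hx le_rfl))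
    | zero =>
      simp only [evalAt_zero]
      have : analyticOrderAt (fun _ : ℂ ↦ (0:ℂ)) z = ⊤ := by
        rw [analyticOrderAt_eq_top]; simp
      rw [this]; exact le_top
    | add x y hx hy ihx ihy =>
      refine (le_min ihx ihy).trans (le_analyticOrderAt_add.trans (le_of_eq ?_))
      congr 1
      funext w
      simp [evalAt_add]

/-- If the ideal of `Z` near `f z` is generated by one function `g`, as for a Cartier divisor, then
`ord_z f^* Z` is the vanishing order of `g ∘ f` at `z`. -/
theorem orderAt_principal (Z : X.IdealSheafData) (U : X.affineOpens) (g : Γ(X, U.1))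
   (hg : Z.ideal U = Ideal.span {g}) (f : ℂ → CPoint X) (S : Set ℂ) (hS : IsOpen S)
   (hf : IsHolomorphicOn f S) (z : ℂ) (hz : z ∈ S) (hU : (f z).pt ∈ U.1) :
   orderAt Z f z = analyticOrderAt (fun w ↦ evalAt U.1 g (f w)) z := by
  have hop : ∀ V : X.Opens, IsOpen {x : CPoint X | x.pt ∈ V} := fun V =>
    TopologicalSpace.isOpen_generateFrom_of_mem ⟨V, 0, Set.univ, isOpen_univ, by simp⟩
  have hnear : ∀ V : X.Opens, (f z).pt ∈ V → ∀ᶠ w in 𝓝 z, w ∈ S ∧ (f w).pt ∈ V := fun V hV =>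
    Filter.Eventually.and (hS.mem_nhds hz) ((hf.1.continuousAt (hS.mem_nhds hz)).eventually ((hop V).mem_nhds hV))
  have han : ∀ (V : X.Opens) (g : Γ(X, V)), (f z).pt ∈ V → AnalyticAt ℂ (fun w ↦ evalAt V g (f w)) z := by
    intro V g hV
    have h1 := hf.2 V g
    rw [Complex.analyticAt_iff_eventually_differentiableAt]
    filter_upwards [(hnear V hV).eventually_nhds] with w hw
    exact h1.differentiableAt hw
  apply le_antisymm
  · exact iInf₂_le_of_le U hU (iInf₂_le_of_le g (by rw [hg]; exact Ideal.mem_span_singleton_self g) le_rfl)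
  · refine le_iInf₂ fun V hV ↦ le_iInf₂ fun h hh ↦ ?_
    obtain ⟨W, hW, hzW, hWle⟩ := X.isBasis_affineOpens.exists_subset_of_mem_open (show (f z).pt ∈ ((U.1 ⊓ V.1 : X.Opens) : Set X) from ⟨hU, hV⟩) (U.1 ⊓ V.1).isOpen
    obtain ⟨W, hW, rfl⟩ := hW
    have hWU : W ≤ U.1 := fun y hy => (hWle hy).1
    have hWV : W ≤ V.1 := fun y hy => (hWle hy).2
    have h1 := Z.map_ideal (U := ⟨W, hW⟩) (V := U) hWU
    have h2 := Z.ideal_le_comap_ideal (U := ⟨W, hW⟩) (V := V) hWV hh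
    rw [hg, Ideal.map_span, Set.image_singleton] at h1
    rw [Ideal.mem_comap, ← h1, Ideal.mem_span_singleton'] at h2
    obtain ⟨a, ha⟩ := h2
    have e1 : (fun w ↦ evalAt V.1 h (f w)) =ᶠ[𝓝 z] (fun w ↦ evalAt W a (f w)) * (fun w ↦ evalAt U.1 g (f w)) := by
      filter_upwards [hnear W hzW] with w hw
      rw [← evalAt_res hWV h _ hw.2]
      have := congrArg (fun t => evalAt W t (f w)) ha
      simp only [evalAt_mul] at this
      simp only [Pi.mul_apply]
      rw [← evalAt_res hWU g _ hw.2]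
      exact this.symm
    rw [analyticOrderAt_congr e1, analyticOrderAt_mul (han W a hzW) (han U.1 g hU)]
    exact le_add_self

/-- The counting function `N(r, f, Z) = ∫_1^r (∑_{|z| < t} ord_z f^* Z) dt / t`. -/
noncomputable def counting (Z : X.IdealSheafData) (f : ℂ → CPoint X) (r : ℝ) : ℝ :=
  ∫ t in (1 : ℝ)..r, (∑' z : Metric.ball (0 : ℂ) t, (orderAt Z f z : ℝ≥0∞)).toReal / t

end

end Nevanlinna

namespace Nevanlinna

/-! ### Restriction of sections and frames. -/

section Sheaf

variable {X : Scheme.{0}}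

/-! The convergence hypothesis enters only as continuous convergence, `ConvergesAt`: `f n w → finf
z` as `n → ∞` and `w → z` jointly. This notion depends only on the Euclidean topology and passes
through every map continuous at `finf z`. For continuous limits it gives uniform convergence on
compact sets. So `g ∘ f n` converges locally uniformly for every regular function `g`, and classical
one-variable theory applies.

Characteristic: locally `log ‖e‖ = ½ log Φ(g₁, …, g_k)` with `Φ` smooth, so the Chern density is a
Levi form evaluated at the value and the first derivative of the holomorphic map `(gᵢ ∘ f)`.
Derivatives converge by Weierstrass, hence so do the densities (`convergesAt_chernDensity`), and two
dominated convergences give the double integral.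

Proximity: `log ‖s‖` is continuous off the divisor, so the integrands converge uniformly on the
circle.

Counting: Hurwitz's theorem (`eventually_tsum_analyticOrderAt_eq`) is applied to one function of the
ideal near each contact point of `finf`. For a divisor this is the local equation, and the count in
`|z| < t` is eventually constant whenever the circle of radius `t` carries no contact point, that
is, for all but finitely many `t`. Dominated convergence concludes. For a general `Z`, a function
attaining the order of `finf` only bounds the orders of `f n` from above, so the counting function
is merely upper semicontinuous (`eventually_counting_lt`). If `finf` meets `Z` inside the disc and
`r > 1`, then `N(r, finf, Z) > 0` and the factor 2 gives the needed room. If `finf` misses the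
closed disc, so does `f n` eventually, and its count is 0. -/

theorem res_res (M : X.Modules) {W V U : X.Opens} (h : W ≤ V) (h' : V ≤ U) (s : Γ(M, U)) :
    res M h (res M h' s) = res M (h.trans h') s := by
  simp only [res]
  rw [← ConcreteCategory.comp_apply, ← Functor.map_comp]
  rfl

theorem res_self (M : X.Modules) {U : X.Opens} (s : Γ(M, U)) : res M le_rfl s = s := by
  simp [res]

theorem exists_affineOpens_le (x : X) {U : X.Opens} (hx : x ∈ U) :
    ∃ W : X.affineOpens, x ∈ W.1 ∧ W.1 ≤ U := by
  obtain ⟨W, hW, hxW, hWU⟩ := X.isBasis_affineOpens.exists_subset_of_mem_open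
    (show x ∈ (U : Set X) from hx) U.isOpen
  obtain ⟨W, hW, rfl⟩ := hW
  exact ⟨⟨W, hW⟩, hxW, hWU⟩

theorem IsFrame.restrict {M : X.Modules} {V U : X.Opens} {e : Γ(M, U)} (he : IsFrame M e)
    (h : V ≤ U) : IsFrame M (res M h e) := by
  intro W hW
  simpa only [res_res] using he W (hW.trans h)

theorem IsFrame.exists_smul_eq {M : X.Modules} {U : X.Opens} {e : Γ(M, U)} (he : IsFrame M e)
    (s : Γ(M, U)) : ∃ g : Γ(X, U), g • e = s := by
  obtain ⟨g, hg⟩ := (he U le_rfl).2 s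
  exact ⟨g, by simpa only [res_self] using hg⟩

theorem LineBundle.exists_affine_frame (L : LineBundle X) (x : X) :
    ∃ (U : X.affineOpens) (e : Γ(L.sheaf, U.1)), x ∈ U.1 ∧ IsFrame L.sheaf e := by
  obtain ⟨U, e, hx, he⟩ := L.exists_frame x
  obtain ⟨W, hxW, hWU⟩ := exists_affineOpens_le x hx
  exact ⟨W, _, hxW, he.restrict hWU⟩

end Sheaf

/-! ### Euclidean topology, values of regular functions, norms of frames. -/

section Geometry

variable {X : Scheme.{0}} [X.Over (Spec (CommRingCat.of ℂ))]

theorem isOpen_setOf_evalAt_mem (U : X.Opens) (g : Γ(X, U)) {W : Set ℂ} (hW : IsOpen W) :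
    IsOpen {x : CPoint X | x.pt ∈ U ∧ evalAt U g x ∈ W} :=
  TopologicalSpace.isOpen_generateFrom_of_mem ⟨U, g, W, hW, rfl⟩

theorem isOpen_setOf_pt_mem (U : X.Opens) : IsOpen {x : CPoint X | x.pt ∈ U} := by
  simpa using isOpen_setOf_evalAt_mem U 0 isOpen_univ

theorem eventually_pt_mem {U : X.Opens} {x : CPoint X} (hx : x.pt ∈ U) :
    ∀ᶠ y in 𝓝 x, y.pt ∈ U :=
  (isOpen_setOf_pt_mem U).mem_nhds hx

theorem continuousAt_evalAt {U : X.Opens} (g : Γ(X, U)) {x : CPoint X} (hx : x.pt ∈ U) :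
    ContinuousAt (evalAt U g) x := by
  intro W hW
  obtain ⟨V, hVW, hV, hxV⟩ := mem_nhds_iff.1 hW
  have := (isOpen_setOf_evalAt_mem U g hV).mem_nhds (show x ∈ _ from ⟨hx, hxV⟩)
  exact Filter.mem_map.2 (mem_of_superset this fun y hy ↦ hVW hy.2)

/-- Basic opens pull back to basic opens, and `Spec ℂ` has a single point, where a scalar is
invertible exactly when it is nonzero. -/
theorem evalAt_ne_zero_iff {U : X.Opens} (g : Γ(X, U)) {x : CPoint X} (hx : x.pt ∈ U) :
    evalAt U g x ≠ 0 ↔ x.pt ∈ X.basicOpen g := by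
  have key : ∀ p : Spec (CommRingCat.of ℂ), p = IsLocalRing.closedPoint ℂ →
      (evalAt U g x ≠ 0 ↔ p ∈ x.hom ⁻¹ᵁ X.basicOpen g) := by
    intro p hp
    have h1 : p ∈ x.hom ⁻¹ᵁ X.basicOpen g ↔ p ∈ (Spec (CommRingCat.of ℂ)).basicOpen
        (x.hom.appLE U ⊤ (x.le_preimage hx) g) := by
      rw [Scheme.basicOpen_appLE]
      exact ⟨fun h ↦ ⟨trivial, h⟩, And.right⟩
    rw [h1, basicOpen_eq_of_affine', evalAt, dif_pos hx]
    subst hp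
    refine Iff.trans ?_ (PrimeSpectrum.mem_basicOpen (R := ℂ) _ (IsLocalRing.closedPoint ℂ)).symm
    simp [IsLocalRing.closedPoint]
  exact key _ rfl

theorem pt_mem_support_iff (Z : X.IdealSheafData) {U : X.affineOpens} {x : CPoint X}
    (hx : x.pt ∈ U.1) : x.pt ∈ Z.support ↔ ∀ g ∈ Z.ideal U, evalAt U.1 g x = 0 := by
  rw [Scheme.IdealSheafData.mem_support_iff_of_mem hx, Scheme.mem_zeroLocus_iff]
  refine forall₂_congr fun g _ ↦ ?_
  rw [← evalAt_ne_zero_iff g hx, not_not]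

/-- Here `g` is the transition function; it has no zeros because both frames have positive norm. -/
theorem HermitianMetric.exists_norm_frame_eq {L : LineBundle X} (h : HermitianMetric L)
    {U V : X.Opens} {e : Γ(L.sheaf, U)} (he : IsFrame L.sheaf e) {e' : Γ(L.sheaf, V)}
    (he' : IsFrame L.sheaf e') :
    ∃ g : Γ(X, U ⊓ V), ∀ x : CPoint X, x.pt ∈ U ⊓ V →
      evalAt (U ⊓ V) g x ≠ 0 ∧ h.norm V e' x = ‖evalAt (U ⊓ V) g x‖ * h.norm U e x := by
  obtain ⟨g, hg⟩ := (he.restrict inf_le_left).exists_smul_eq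
    (res L.sheaf (inf_le_right : U ⊓ V ≤ V) e')
  have key : ∀ x : CPoint X, x.pt ∈ U ⊓ V →
      h.norm V e' x = ‖evalAt (U ⊓ V) g x‖ * h.norm U e x := by
    intro x hx
    rw [← h.norm_res inf_le_right e' x hx, ← hg, h.norm_smul _ _ _ hx, h.norm_res _ _ _ hx]
  refine ⟨g, fun x hx ↦ ⟨fun h0 ↦ ?_, key x hx⟩⟩
  have := h.norm_pos e' he' x hx.2
  rw [key x hx, h0] at this
  simp at this

theorem SmoothAt.continuousAt {φ : CPoint X → ℝ} {x : CPoint X} (hφ : SmoothAt φ x) :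
    ContinuousAt φ x := by
  obtain ⟨U, k, g, Φ, hx, hΦ, heq⟩ := hφ
  refine ContinuousAt.congr ?_ (heq.mono fun y hy ↦ hy.symm)
  exact hΦ.continuous.continuousAt.comp
    (continuousAt_pi.2 fun i ↦ continuousAt_evalAt (g i) hx)

theorem HermitianMetric.continuousAt_log_norm_frame {L : LineBundle X} (h : HermitianMetric L)
    {U : X.Opens} {e : Γ(L.sheaf, U)} (he : IsFrame L.sheaf e) {x : CPoint X} (hx : x.pt ∈ U) :
    ContinuousAt (fun y ↦ Real.log (h.norm U e y)) x := by
  -- Smoothness is given for the squared norm; the factor `1 / 2` undoes the square inside the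
  -- logarithm.
  have h1 := ((h.smooth e he x hx).continuousAt.log
    (pow_pos (h.norm_pos e he x hx) 2).ne').const_mul (1 / 2)
  refine h1.congr (Eventually.of_forall fun y ↦ ?_)
  simp [Real.log_pow]

end Geometry

/-! ### Continuous convergence and compactness. -/

section ContinuousConvergence

variable {Y Y' : Type*} [TopologicalSpace Y] [TopologicalSpace Y']

/-- Continuous convergence at `z`: `F n w → f z` as `n → ∞` and `w → z`. -/
def ConvergesAt (F : ℕ → ℂ → Y) (f : ℂ → Y) (z : ℂ) : Prop :=
  Tendsto (fun p : ℕ × ℂ ↦ F p.1 p.2) (atTop ×ˢ 𝓝 z) (𝓝 (f z))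

theorem ConvergesAt.tendsto {F : ℕ → ℂ → Y} {f : ℂ → Y} {z : ℂ} (h : ConvergesAt F f z) :
    Tendsto (fun n ↦ F n z) atTop (𝓝 (f z)) :=
  Tendsto.comp h (tendsto_id.prodMk tendsto_const_pure |>.mono_right
    (Filter.prod_mono le_rfl (pure_le_nhds z)))

theorem convergesAt_const {f : ℂ → Y} {z : ℂ} (h : ContinuousAt f z) :
    ConvergesAt (fun _ ↦ f) f z :=
  Tendsto.comp h tendsto_snd

/-- Lets a continuity statement be read off from a convergence statement applied to a constant
sequence. -/
theorem ConvergesAt.continuousAt_of_const {f : ℂ → Y} {z : ℂ}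
    (h : ConvergesAt (fun _ ↦ f) f z) : ContinuousAt f z := by
  have h' : Tendsto (f ∘ Prod.snd) ((atTop : Filter ℕ) ×ˢ 𝓝 z) (𝓝 (f z)) := h
  rwa [← tendsto_map'_iff, Filter.map_snd_prod] at h'

theorem ConvergesAt.comp {F : ℕ → ℂ → Y} {f : ℂ → Y} {z : ℂ} {φ : Y → Y'}
    (hφ : ContinuousAt φ (f z)) (h : ConvergesAt F f z) :
    ConvergesAt (fun n w ↦ φ (F n w)) (fun w ↦ φ (f w)) z :=
  Tendsto.comp hφ h

theorem ConvergesAt.congr {F G : ℕ → ℂ → Y} {f g : ℂ → Y} {z : ℂ} (h : ConvergesAt F f z)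
    (hFG : ∀ᶠ p : ℕ × ℂ in atTop ×ˢ 𝓝 z, F p.1 p.2 = G p.1 p.2) (hfg : f z = g z) :
    ConvergesAt G g z := by
  unfold ConvergesAt
  rw [← hfg]
  exact Tendsto.congr' hFG h

/-- A tube lemma: for compact `K`, the product of `l` with the neighbourhoods of `K` is the supremum
of the products at its points. -/
theorem eventually_forall_of_isCompact {ι : Type*} {l : Filter ι} {K : Set ℂ}
    (hK : IsCompact K) {P : ι → ℂ → Prop} (hP : ∀ z ∈ K, ∀ᶠ p in l ×ˢ 𝓝 z, P p.1 p.2) :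
    ∀ᶠ n in l, ∀ z ∈ K, P n z := by
  simp only [← eventually_iSup, ← hK.prod_nhdsSet_eq_biSup] at hP
  exact hP.curry.mono fun _ h ↦ h.self_of_nhdsSet

variable {E : Type*} [PseudoMetricSpace E]

theorem tendstoUniformlyOn_of_convergesAt {F : ℕ → ℂ → E} {f : ℂ → E} {K : Set ℂ}
    (hK : IsCompact K) (h : ∀ z ∈ K, ConvergesAt F f z) (hf : ∀ z ∈ K, ContinuousAt f z) :
    TendstoUniformlyOn F f atTop K := by
  rw [← tendstoLocallyUniformlyOn_iff_tendstoUniformlyOn_of_compact hK,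
    tendstoLocallyUniformlyOn_iff_forall_tendsto]
  intro z hz
  refine (Tendsto.mono_right ?_ (nhds_prod_eq.symm.trans_le (nhds_le_uniformity (f z)))).mono_left
    (Filter.prod_mono le_rfl nhdsWithin_le_nhds)
  exact Tendsto.prodMk (Tendsto.comp (hf z hz) tendsto_snd) (h z hz)

theorem TendstoLocallyUniformlyOn.convergesAt {F : ℕ → ℂ → E} {f : ℂ → E} {U : Set ℂ}
    (hU : IsOpen U) (h : TendstoLocallyUniformlyOn F f atTop U) (hf : ContinuousOn f U)
    {z : ℂ} (hz : z ∈ U) : ConvergesAt F f z := by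
  rw [hU.tendstoLocallyUniformlyOn_iff_forall_tendsto] at h
  have h1 := h z hz
  have h2 : Tendsto (fun p : ℕ × ℂ ↦ f p.2) (atTop ×ˢ 𝓝 z) (𝓝 (f z)) :=
    Tendsto.comp (hf.continuousAt (hU.mem_nhds hz)) tendsto_snd
  unfold ConvergesAt
  rw [tendsto_iff_dist_tendsto_zero] at h2 ⊢
  rw [tendsto_uniformity_iff_dist_tendsto_zero] at h1
  have h3 := h1.add h2
  rw [add_zero] at h3
  refine squeeze_zero (fun _ ↦ dist_nonneg) (fun p ↦ ?_) h3
  rw [dist_comm (f p.2)]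
  exact dist_triangle _ _ _

theorem exists_eventually_norm_le_of_convergesAt {E : Type*} [SeminormedAddCommGroup E]
    {F : ℕ → ℂ → E} {f : ℂ → E} {K : Set ℂ} (hK : IsCompact K)
    (h : ∀ z ∈ K, ConvergesAt F f z) (hf : ∀ z ∈ K, ContinuousAt f z) :
    ∃ C, ∀ᶠ n in atTop, ∀ z ∈ K, ‖F n z‖ ≤ C := by
  obtain ⟨C, hC⟩ := hK.exists_bound_of_continuousOn
    (fun z hz ↦ (hf z hz).continuousWithinAt)
  refine ⟨C + 1, ?_⟩
  filter_upwards [Metric.tendstoUniformlyOn_iff.1 (tendstoUniformlyOn_of_convergesAt hK h hf)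
    1 one_pos] with n hn z hz
  have h1 := hn z hz
  rw [dist_eq_norm, norm_sub_rev] at h1
  have := norm_le_norm_add_norm_sub' (F n z) (f z)
  linarith [hC z hz]

theorem tendsto_circleAverage {F : ℕ → ℂ → ℝ} {f : ℂ → ℝ} {c : ℂ} {R : ℝ}
    (hF : ∀ᶠ n in atTop, ContinuousOn (F n) (Metric.sphere c |R|))
    (h : TendstoUniformlyOn F f atTop (Metric.sphere c |R|)) :
    Tendsto (fun n ↦ Real.circleAverage (F n) c R) atTop (𝓝 (Real.circleAverage f c R)) := by
  unfold Real.circleAverage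
  refine Tendsto.const_smul ?_ _
  have hm : Set.MapsTo (circleMap c R) (Set.uIcc 0 (2 * Real.pi)) (Metric.sphere c |R|) :=
    fun θ _ ↦ circleMap_mem_sphere' c R θ
  refine TendstoUniformlyOn.tendsto_intervalIntegral_of_continuousOn ?_ ?_
  · filter_upwards [hF] with n hn
    exact hn.comp (continuous_circleMap c R).continuousOn hm
  · exact (h.comp (circleMap c R)).mono hm

end ContinuousConvergence

/-! ### Hurwitz's theorem from Jensen's formula. -/

section Hurwitz

open Metric MeromorphicOn

/-- All zeros lie in `ball c a`, so Jensen's formulas at radii `a` and `b` have the same divisor and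
the same trailing coefficient; only `log R` changes. The zero count thus becomes a quantity
continuous under uniform convergence on two circles. -/
theorem AnalyticOnNhd.exists_tsum_analyticOrderAt_eq_circleAverage_sub {G : ℂ → ℂ} {c : ℂ}
    {a b : ℝ} (ha : 0 < a) (hab : a < b) (hG : AnalyticOnNhd ℂ G (closedBall c b))
    (hne : ∀ z ∈ closedBall c b \ ball c a, G z ≠ 0) :
    ∃ M : ℕ, (∑' z : ball c a, (analyticOrderAt G z : ℝ≥0∞)) = M ∧
      Real.circleAverage (fun z ↦ Real.log ‖G z‖) c b -
        Real.circleAverage (fun z ↦ Real.log ‖G z‖) c a = M * (Real.log b - Real.log a) := by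
  have hb : 0 < b := ha.trans hab
  have hGa : AnalyticOnNhd ℂ G (closedBall c a) :=
    hG.mono (closedBall_subset_closedBall hab.le)
  have hfin : ∀ z ∈ closedBall c b, analyticOrderAt G z ≠ ⊤ := by
    -- A point of the outer circle shows that `G` is not identically zero, so all orders are finite.
    have hw : c + b ∈ closedBall c b \ ball c a := by
      simp [abs_of_pos hb, hab.le]
    have hw' : analyticOrderAt G (c + b) ≠ ⊤ := by
      rw [((hG _ hw.1).analyticOrderAt_eq_zero).2 (hne _ hw)]
      simp
    intro z hz
    exact hG.analyticOrderAt_ne_top_of_isPreconnected (convex_closedBall c b).isPreconnected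
      hw.1 hz hw'
  set D := divisor G (closedBall c b) with hD
  have hDfin : (D : ℂ → ℤ).HasFiniteSupport := D.finiteSupport (isCompact_closedBall c b)
  have hDval : ∀ z ∈ closedBall c b, D z = ((analyticOrderAt G z).toNat : ℤ) := by
    intro z hz
    rw [hD, hG.divisor_apply hz]
    obtain ⟨k, hk⟩ := ENat.ne_top_iff_exists.1 (hfin z hz)
    rw [← hk]
    simp
  have hDball : ∀ z, z ∉ ball c a → D z = 0 := by
    intro z hz
    by_cases hzb : z ∈ closedBall c b
    · rw [hDval z hzb, ((hG z hzb).analyticOrderAt_eq_zero).2 (hne z ⟨hzb, hz⟩)]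
      simp
    · exact D.apply_eq_zero_of_notMem hzb
  have hDa : (divisor G (closedBall c a) : ℂ → ℤ) = D := by
    ext z
    by_cases hz : z ∈ closedBall c a
    · rw [hGa.divisor_apply hz, hD, hG.divisor_apply (closedBall_subset_closedBall hab.le hz)]
    · rw [Function.locallyFinsuppWithin.apply_eq_zero_of_notMem _ hz,
        hDball z fun h ↦ hz (ball_subset_closedBall h)]
  set S := hDfin.toFinset
  have hS : ∀ z, z ∈ S ↔ D z ≠ 0 := fun z ↦ Set.Finite.mem_toFinset hDfin
  refine ⟨∑ z ∈ S, (analyticOrderAt G z).toNat, ?_, ?_⟩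
  · rw [tsum_subtype (ball c a) (fun z ↦ ((analyticOrderAt G z : ℕ∞) : ℝ≥0∞)), tsum_eq_sum (s := S)]
    · push_cast
      refine Finset.sum_congr rfl fun z hz ↦ ?_
      have hza : z ∈ ball c a := by
        by_contra h
        exact (hS z).1 hz (hDball z h)
      rw [Set.indicator_of_mem hza]
      obtain ⟨k, hk⟩ := ENat.ne_top_iff_exists.1
        (hfin z (ball_subset_closedBall (ball_subset_ball hab.le hza)))
      rw [← hk]
      simp
    · intro z hz
      by_cases hza : z ∈ ball c a
      · have hzb := ball_subset_closedBall (ball_subset_ball hab.le hza)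
        have h1 := not_not.1 (mt (hS z).2 hz)
        rw [hDval z hzb] at h1
        rw [Set.indicator_of_mem hza]
        obtain ⟨k, hk⟩ := ENat.ne_top_iff_exists.1 (hfin z hzb)
        rw [← hk] at h1 ⊢
        simpa using h1
      · exact Set.indicator_of_notMem hza _
  · have jensen : ∀ R : ℝ, 0 < R → AnalyticOnNhd ℂ G (closedBall c R) →
        (divisor G (closedBall c R) : ℂ → ℤ) = D →
        Real.circleAverage (fun z ↦ Real.log ‖G z‖) c R =
          ∑ z ∈ S, (D z : ℝ) * (Real.log R - Real.log ‖c - z‖) +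
            Real.log ‖meromorphicTrailingCoeffAt G c‖ := by
      intro R hR hGR hDR
      have h1 := MeromorphicOn.circleAverage_log_norm (c := c) (f := G) hR.ne'
        (by rw [abs_of_pos hR]; exact hGR.meromorphicOn)
      -- Since `0⁻¹ = 0` and `log 0 = 0`, the separate Jensen term for a zero at the centre is
      -- absorbed into a single sum of `log R - log ‖c - z‖`.
      rw [abs_of_pos hR, hDR, ← countingFunction_finsum_eq_finsum_add hR.ne' hDfin] at h1
      rw [h1, finsum_eq_sum_of_support_subset]
      intro z hz
      by_contra h
      exact hz (by simp [not_not.1 (mt (hS z).2 h)])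
    rw [jensen b hb hG rfl, jensen a ha hGa hDa, add_sub_add_right_eq_sub,
      ← Finset.sum_sub_distrib]
    push_cast
    rw [Finset.sum_mul]
    refine Finset.sum_congr rfl fun z hz ↦ ?_
    have hzb : z ∈ closedBall c b := by
      by_contra h
      exact (hS z).1 hz (D.apply_eq_zero_of_notMem h)
    rw [hDval z hzb]
    push_cast
    ring

/-- On the annulus `δ ≤ |z - c| ≤ b` the limit has no zeros, hence neither does `G n` eventually,
and the circle averages of `log ‖G n‖` converge. The zero counts are integers converging to an
integer, so they are eventually equal to it. -/
theorem eventually_tsum_analyticOrderAt_eq {G : ℕ → ℂ → ℂ} {g : ℂ → ℂ} {c : ℂ} {ρ : ℝ}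
    (hG : ∀ᶠ n in atTop, DifferentiableOn ℂ (G n) (ball c ρ))
    (hg : DifferentiableOn ℂ g (ball c ρ))
    (hconv : ∀ z ∈ ball c ρ, ConvergesAt G g z)
    (hne : ∀ z ∈ ball c ρ, z ≠ c → g z ≠ 0) {δ : ℝ} (hδ : 0 < δ) (hδρ : δ < ρ) :
    ∀ᶠ n in atTop, (∑' z : ball c δ, (analyticOrderAt (G n) z : ℝ≥0∞)) =
      (analyticOrderAt g c : ℝ≥0∞) := by
  obtain ⟨b, hδb, hbρ⟩ := exists_between hδρ
  have hsub : closedBall c b ⊆ ball c ρ := closedBall_subset_ball hbρ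
  have hanal : ∀ u : ℂ → ℂ, DifferentiableOn ℂ u (ball c ρ) →
      AnalyticOnNhd ℂ u (closedBall c b) := fun u hu z hz ↦
    hu.analyticAt (isOpen_ball.mem_nhds (hsub hz))
  have hann : ∀ z ∈ closedBall c b \ ball c δ, g z ≠ 0 := fun z hz ↦
    hne z (hsub hz.1) fun h ↦ hz.2 (h ▸ mem_ball_self hδ)
  have hK : IsCompact (closedBall c b \ ball c δ) := (isCompact_closedBall c b).diff isOpen_ball
  have hannG : ∀ᶠ n in atTop, ∀ z ∈ closedBall c b \ ball c δ, G n z ≠ 0 := by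
    refine eventually_forall_of_isCompact hK fun z hz ↦ ?_
    exact (show Tendsto _ _ _ from hconv z (hsub hz.1)).eventually_ne (hann z hz)
  obtain ⟨M, hM, hMavg⟩ := AnalyticOnNhd.exists_tsum_analyticOrderAt_eq_circleAverage_sub
    hδ hδb (hanal g hg) hann
  have hM' : (analyticOrderAt g c : ℝ≥0∞) = M := by
    rw [← hM, tsum_eq_single (⟨c, mem_ball_self hδ⟩ : ball c δ)]
    intro z hz
    have hzb : (z : ℂ) ∈ closedBall c b := ball_subset_closedBall (ball_subset_ball hδb.le z.2)
    rw [((hanal g hg _ hzb).analyticOrderAt_eq_zero).2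
      (hne _ (hsub hzb) fun h ↦ hz (Subtype.ext h))]
    simp
  have havg : ∀ R, δ ≤ R → R ≤ b →
      Tendsto (fun n ↦ Real.circleAverage (fun z ↦ Real.log ‖G n z‖) c R)
      atTop (𝓝 (Real.circleAverage (fun z ↦ Real.log ‖g z‖) c R)) := by
    intro R hR hRb
    have hR0 : 0 < R := hδ.trans_le hR
    have hsph : sphere c |R| ⊆ closedBall c b \ ball c δ := by
      intro z hz
      rw [abs_of_pos hR0, mem_sphere] at hz
      simp [hz, hR, hRb]
    have hlog : ∀ u : ℂ → ℂ, ∀ z, ContinuousAt u z → u z ≠ 0 →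
        ContinuousAt (fun z ↦ Real.log ‖u z‖) z := fun u z hu hz ↦
      hu.norm.log (norm_ne_zero_iff.2 hz)
    refine tendsto_circleAverage ?_ (tendstoUniformlyOn_of_convergesAt (isCompact_sphere _ _) ?_ ?_)
    · filter_upwards [hG, hannG] with n hn hn' z hz
      exact (hlog _ z (hanal _ hn z (hsph hz).1).continuousAt
        (hn' z (hsph hz))).continuousWithinAt
    · intro z hz
      exact (hconv z (hsub (hsph hz).1)).comp
        (φ := fun y ↦ Real.log ‖y‖) (hlog id _ continuousAt_id (hann z (hsph hz)))
    · intro z hz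
      exact hlog _ z (hanal _ hg z (hsph hz).1).continuousAt (hann z (hsph hz))
  have hlogpos : 0 < Real.log b - Real.log δ := sub_pos.2 (Real.log_lt_log hδ hδb)
  have hlim := ((havg b hδb.le le_rfl).sub (havg δ le_rfl hδb.le)).div_const
    (Real.log b - Real.log δ)
  rw [hMavg, mul_div_cancel_right₀ _ hlogpos.ne'] at hlim
  filter_upwards [hG, hannG, hlim.eventually (Metric.ball_mem_nhds (M : ℝ) one_half_pos)]
    with n hn hn' hd
  obtain ⟨k, hk, hkavg⟩ := AnalyticOnNhd.exists_tsum_analyticOrderAt_eq_circleAverage_sub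
    hδ hδb (hanal _ hn) hn'
  rw [hkavg, mul_div_cancel_right₀ _ hlogpos.ne', Real.dist_eq] at hd
  have hkM : k = M := by
    have h1 : |(k : ℤ) - (M : ℤ)| < 1 := by
      have : |(k : ℝ) - M| < 1 := hd.trans one_half_lt_one
      exact_mod_cast this
    rw [Int.abs_lt_one_iff] at h1
    omega
  rw [hk, hM', hkM]

end Hurwitz

/-! ### Contact orders with a closed subscheme and their local stability. -/

section Counting

open Metric

variable {X : Scheme.{0}} [X.Over (Spec (CommRingCat.of ℂ))]

theorem IsHolomorphicOn.mono {f : ℂ → CPoint X} {S T : Set ℂ} (hf : IsHolomorphicOn f S)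
    (hTS : T ⊆ S) : IsHolomorphicOn f T :=
  ⟨hf.1.mono hTS, fun U g ↦ (hf.2 U g).mono fun _ hz ↦ ⟨hTS hz.1, hz.2⟩⟩

theorem IsHolomorphicOn.eventually_pt_mem {f : ℂ → CPoint X} {S : Set ℂ}
    (hf : IsHolomorphicOn f S) (hS : IsOpen S) {z : ℂ} (hz : z ∈ S) {U : X.Opens}
    (hU : (f z).pt ∈ U) : ∀ᶠ w in 𝓝 z, w ∈ S ∧ (f w).pt ∈ U :=
  Filter.Eventually.and (hS.mem_nhds hz)
    ((hf.1.continuousAt (hS.mem_nhds hz)).eventually (Nevanlinna.eventually_pt_mem hU))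

theorem IsHolomorphicOn.analyticAt {f : ℂ → CPoint X} {S : Set ℂ}
    (hf : IsHolomorphicOn f S) (hS : IsOpen S) {z : ℂ} (hz : z ∈ S) {U : X.Opens}
    (hU : (f z).pt ∈ U) (g : Γ(X, U)) : AnalyticAt ℂ (fun w ↦ evalAt U g (f w)) z := by
  rw [Complex.analyticAt_iff_eventually_differentiableAt]
  filter_upwards [(hf.eventually_pt_mem hS hz hU).eventually_nhds] with w hw
  exact (hf.2 U g).differentiableAt hw

theorem orderAt_le_analyticOrderAt (Z : X.IdealSheafData) (f : ℂ → CPoint X) {z : ℂ}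
    {U : X.affineOpens} (hU : (f z).pt ∈ U.1) {g : Γ(X, U.1)} (hg : g ∈ Z.ideal U) :
    orderAt Z f z ≤ analyticOrderAt (fun w ↦ evalAt U.1 g (f w)) z :=
  iInf₂_le_of_le U hU (iInf₂_le_of_le g hg le_rfl)

theorem exists_analyticOrderAt_eq_orderAt {Z : X.IdealSheafData} {f : ℂ → CPoint X} {z : ℂ}
    (h : orderAt Z f z ≠ ⊤) : ∃ (U : X.affineOpens) (g : Γ(X, U.1)), (f z).pt ∈ U.1 ∧
      g ∈ Z.ideal U ∧ analyticOrderAt (fun w ↦ evalAt U.1 g (f w)) z = orderAt Z f z := by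
  -- A finite infimum in `ℕ∞` is attained: some member lies below the infimum plus one.
  have h1 : orderAt Z f z < orderAt Z f z + 1 := (ENat.lt_add_one_iff h).2 le_rfl
  conv_lhs at h1 => unfold orderAt
  simp only [iInf_lt_iff] at h1
  obtain ⟨U, hU, g, hg, h1⟩ := h1
  exact ⟨U, g, hU, hg, le_antisymm ((ENat.lt_add_one_iff h).1 h1)
    (orderAt_le_analyticOrderAt Z f hU hg)⟩

theorem IsHolomorphicOn.orderAt_eq_zero {f : ℂ → CPoint X} {S : Set ℂ}
    (hf : IsHolomorphicOn f S) (hS : IsOpen S) {z : ℂ} (hz : z ∈ S) {Z : X.IdealSheafData}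
    (h : (f z).pt ∉ Z.support) : orderAt Z f z = 0 := by
  obtain ⟨U, hU, -⟩ := exists_affineOpens_le (U := ⊤) (f z).pt trivial
  rw [pt_mem_support_iff Z hU] at h
  push Not at h
  obtain ⟨g, hg, hne⟩ := h
  refine le_antisymm ((orderAt_le_analyticOrderAt Z f hU hg).trans ?_) zero_le
  rw [((hf.analyticAt hS hz hU g).analyticOrderAt_eq_zero).2 hne]

theorem IsHolomorphicOn.one_le_orderAt {f : ℂ → CPoint X} {S : Set ℂ}
    (hf : IsHolomorphicOn f S) (hS : IsOpen S) {z : ℂ} (hz : z ∈ S) {Z : X.IdealSheafData}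
    (h : (f z).pt ∈ Z.support) : 1 ≤ orderAt Z f z := by
  refine le_iInf₂ fun U hU ↦ le_iInf₂ fun g hg ↦ ?_
  rw [Order.one_le_iff_ne_zero, Ne, (hf.analyticAt hS hz hU g).analyticOrderAt_eq_zero, not_not]
  exact (pt_mem_support_iff Z hU).1 h g hg

theorem IsHolomorphicOn.eventually_notMem_support {f : ℂ → CPoint X} {S : Set ℂ}
    (hf : IsHolomorphicOn f S) (hS : IsOpen S) {z : ℂ} (hz : z ∈ S) {Z : X.IdealSheafData}
    (h : orderAt Z f z ≠ ⊤) : ∀ᶠ w in 𝓝[≠] z, (f w).pt ∉ Z.support := by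
  obtain ⟨U, g, hU, hg, heq⟩ := exists_analyticOrderAt_eq_orderAt h
  have h1 := (hf.analyticAt hS hz hU g).eventually_eq_zero_or_eventually_ne_zero.resolve_left
    fun h0 ↦ h (by rw [← heq, analyticOrderAt_eq_top]; exact h0)
  filter_upwards [h1, (hf.eventually_pt_mem hS hz hU).filter_mono nhdsWithin_le_nhds]
    with w hw hwU hmem
  exact hw ((pt_mem_support_iff Z hwU.2).1 hmem g hg)

/-- A holomorphic map of a connected domain whose image is not contained in `Z` has everywhere
finite contact order with `Z`. -/
theorem IsHolomorphicOn.orderAt_ne_top {f : ℂ → CPoint X} {S : Set ℂ}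
    (hf : IsHolomorphicOn f S) (hS : IsOpen S) (hconn : IsPreconnected S) {Z : X.IdealSheafData}
    (h : ∃ z ∈ S, (f z).pt ∉ Z.support) {z : ℂ} (hz : z ∈ S) : orderAt Z f z ≠ ⊤ := by
  -- On a small ball either all functions of the ideal pull back to zero, or one does not and then
  -- has finite order throughout by the identity theorem.
  have hloc : ∀ z ∈ S, (∀ᶠ w in 𝓝 z, (f w).pt ∈ Z.support) ∨ ∀ᶠ w in 𝓝 z, orderAt Z f w ≠ ⊤ := by
    intro z hz
    obtain ⟨U, hU, -⟩ := exists_affineOpens_le (U := ⊤) (f z).pt trivial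
    obtain ⟨ε, hε, hball⟩ := Metric.eventually_nhds_iff_ball.1 (hf.eventually_pt_mem hS hz hU)
    have han : ∀ g : Γ(X, U.1), AnalyticOnNhd ℂ (fun w ↦ evalAt U.1 g (f w)) (ball z ε) :=
      fun g w hw ↦ hf.analyticAt hS (hball w hw).1 (hball w hw).2 g
    by_cases hzero : ∀ g ∈ Z.ideal U, ∀ w ∈ ball z ε, evalAt U.1 g (f w) = 0
    · left
      filter_upwards [ball_mem_nhds z hε] with w hw
      exact (pt_mem_support_iff Z (hball w hw).2).2 fun g hg ↦ hzero g hg w hw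
    · right
      push Not at hzero
      obtain ⟨g, hg, w₀, hw₀, hne⟩ := hzero
      filter_upwards [ball_mem_nhds z hε] with w hw
      refine ne_top_of_le_ne_top ?_ (orderAt_le_analyticOrderAt Z f (hball w hw).2 hg)
      refine (han g).analyticOrderAt_ne_top_of_isPreconnected (convex_ball z ε).isPreconnected
        hw₀ hw ?_
      rw [((han g w₀ hw₀).analyticOrderAt_eq_zero).2 hne]
      simp
  have hdisj : ∀ z ∈ S, (∀ᶠ w in 𝓝 z, (f w).pt ∈ Z.support) → ¬ ∀ᶠ w in 𝓝 z, orderAt Z f w ≠ ⊤ := by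
    intro z hz h1 h2
    have h3 := hf.eventually_notMem_support hS hz h2.self_of_nhds
    obtain ⟨w, hw, hw'⟩ := (h3.and (h1.filter_mono nhdsWithin_le_nhds)).exists
    exact hw hw'
  obtain ⟨z₀, hz₀, hz₀Z⟩ := h
  -- The two alternatives are disjoint open conditions covering `S`, so connectedness selects the
  -- one holding at `z₀`.
  have hsub := hconn.subset_left_of_subset_union
    (u := {z | ∀ᶠ w in 𝓝 z, orderAt Z f w ≠ ⊤}) (v := {z | ∀ᶠ w in 𝓝 z, (f w).pt ∈ Z.support} ∩ S)
    isOpen_setOfPred_eventually_nhds (isOpen_setOfPred_eventually_nhds.inter hS)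
    (Set.disjoint_left.2 fun z h1 h2 ↦ hdisj z h2.2 h2.1 h1)
    (fun z hz ↦ (hloc z hz).symm.imp id fun h ↦ ⟨h, hz⟩)
    ⟨z₀, hz₀, (hloc z₀ hz₀).resolve_left fun h ↦ hz₀Z h.self_of_nhds⟩
  exact (hsub hz).self_of_nhds

theorem ConvergesAt.evalAt {f : ℕ → ℂ → CPoint X} {F : ℂ → CPoint X} {z : ℂ}
    (h : ConvergesAt f F z) {U : X.Opens} (hU : (F z).pt ∈ U) (g : Γ(X, U)) :
    ConvergesAt (fun n w ↦ evalAt U g (f n w)) (fun w ↦ evalAt U g (F w)) z :=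
  h.comp (continuousAt_evalAt g hU)

theorem ConvergesAt.eventually_pt_mem {f : ℕ → ℂ → CPoint X} {F : ℂ → CPoint X} {z : ℂ}
    (h : ConvergesAt f F z) {U : X.Opens} (hU : (F z).pt ∈ U) :
    ∀ᶠ p : ℕ × ℂ in atTop ×ˢ 𝓝 z, (f p.1 p.2).pt ∈ U :=
  Tendsto.eventually (p := fun y : CPoint X ↦ y.pt ∈ U) h (Nevanlinna.eventually_pt_mem hU)

theorem eventually_forall_notMem_support {f : ℕ → ℂ → CPoint X} {F : ℂ → CPoint X} {K : Set ℂ}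
    (hK : IsCompact K) (h : ∀ z ∈ K, ConvergesAt f F z) {Z : X.IdealSheafData}
    (hZ : ∀ z ∈ K, (F z).pt ∉ Z.support) : ∀ᶠ n in atTop, ∀ z ∈ K, (f n z).pt ∉ Z.support :=
  eventually_forall_of_isCompact hK fun z hz ↦
    (h z hz).eventually_pt_mem (U := ⟨(Z.support : Set X)ᶜ, Z.support.isClosed.isOpen_compl⟩)
      (hZ z hz)

theorem exists_ball_forall_of_eventually {f : ℕ → ℂ → CPoint X} {F : ℂ → CPoint X} {S : Set ℂ}
    (hS : IsOpen S) (hF : IsHolomorphicOn F S) {z : ℂ} (hz : z ∈ S) (h : ConvergesAt f F z)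
    {P : CPoint X → Prop} (hP : ∀ᶠ y in 𝓝 (F z), P y) :
    ∃ ρ > 0, ball z ρ ⊆ S ∧ (∀ w ∈ ball z ρ, P (F w)) ∧
      ∀ᶠ n in atTop, ∀ w ∈ ball z ρ, P (f n w) := by
  obtain ⟨A, hA, B, hB, hAB⟩ := Filter.eventually_prod_iff.1 (Tendsto.eventually h hP)
  have hz' : ∀ᶠ w in 𝓝 z, w ∈ S := hS.mem_nhds hz
  obtain ⟨ρ, hρ, hball⟩ := Metric.eventually_nhds_iff_ball.1
    (hB.and (hz'.and ((hF.1.continuousAt (hS.mem_nhds hz)).eventually hP)))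
  exact ⟨ρ, hρ, fun w hw ↦ (hball w hw).2.1, fun w hw ↦ (hball w hw).2.2,
    hA.mono fun n hn w hw ↦ hAB hn (hball w hw).1⟩

theorem exists_eventually_tsum_analyticOrderAt_evalAt_eq {f : ℕ → ℂ → CPoint X}
    {F : ℂ → CPoint X} {S : Set ℂ} (hS : IsOpen S) (hf : ∀ᶠ n in atTop, IsHolomorphicOn (f n) S)
    (hF : IsHolomorphicOn F S) (hc : ∀ z ∈ S, ConvergesAt f F z) {z : ℂ} (hz : z ∈ S)
    {U : X.Opens} (hU : (F z).pt ∈ U) (g : Γ(X, U))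
    (hg : analyticOrderAt (fun w ↦ evalAt U g (F w)) z ≠ ⊤) :
    ∃ ρ > 0, ∀ δ, 0 < δ → δ < ρ → ∀ᶠ n in atTop, (∀ w ∈ ball z δ, w ∈ S ∧ (f n w).pt ∈ U) ∧
      (∑' w : ball z δ, (analyticOrderAt (fun w ↦ evalAt U g (f n w)) w : ℝ≥0∞)) =
        (analyticOrderAt (fun w ↦ evalAt U g (F w)) z : ℝ≥0∞) := by
  obtain ⟨ρ₁, hρ₁, hS₁, hF₁, hf₁⟩ := exists_ball_forall_of_eventually hS hF hz (hc z hz)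
    (Nevanlinna.eventually_pt_mem hU)
  have hne := (hF.analyticAt hS hz hU g).eventually_eq_zero_or_eventually_ne_zero.resolve_left
    fun h0 ↦ hg (analyticOrderAt_eq_top.2 h0)
  obtain ⟨ρ₂, hρ₂, hne⟩ := Metric.eventually_nhds_iff_ball.1 (eventually_nhdsWithin_iff.1 hne)
  have hsub₁ := ball_subset_ball (x := z) (min_le_left ρ₁ ρ₂)
  have hsub₂ := ball_subset_ball (x := z) (min_le_right ρ₁ ρ₂)
  refine ⟨min ρ₁ ρ₂, lt_min hρ₁ hρ₂, fun δ hδ hδρ ↦ ?_⟩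
  have hdiff : ∀ u : ℂ → CPoint X, IsHolomorphicOn u S → (∀ w ∈ ball z ρ₁, (u w).pt ∈ U) →
      DifferentiableOn ℂ (fun w ↦ evalAt U g (u w)) (ball z (min ρ₁ ρ₂)) := fun u hu huU ↦
    (hu.2 U g).mono fun w hw ↦ ⟨hS₁ (hsub₁ hw), huU w (hsub₁ hw)⟩
  filter_upwards [hf₁, eventually_tsum_analyticOrderAt_eq
    (hf₁.mp (hf.mono fun n h1 h2 ↦ hdiff (f n) h1 h2)) (hdiff F hF hF₁)
    (fun w hw ↦ (hc w (hS₁ (hsub₁ hw))).evalAt (hF₁ w (hsub₁ hw)) g)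
    (fun w hw hwz ↦ hne w (hsub₂ hw) hwz) hδ hδρ] with n hn hn'
  have hsub := ball_subset_ball (x := z) (hδρ.le.trans (min_le_left ρ₁ ρ₂))
  exact ⟨fun w hw ↦ ⟨hS₁ (hsub hw), hn w (hsub hw)⟩, hn'⟩

/-- Hurwitz for a function `g` of the ideal attaining the order of `F` at `z`. For `f n` another
function of the ideal may vanish to lower order, hence only an inequality. -/
theorem exists_eventually_tsum_orderAt_le {f : ℕ → ℂ → CPoint X}
    {F : ℂ → CPoint X} {S : Set ℂ} (hS : IsOpen S) (hf : ∀ᶠ n in atTop, IsHolomorphicOn (f n) S)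
    (hF : IsHolomorphicOn F S) (hc : ∀ z ∈ S, ConvergesAt f F z) {Z : X.IdealSheafData}
    {z : ℂ} (hz : z ∈ S) (hZ : orderAt Z F z ≠ ⊤) :
    ∃ ρ > 0, ∀ δ, 0 < δ → δ < ρ → ∀ᶠ n in atTop,
      (∑' w : ball z δ, (orderAt Z (f n) w : ℝ≥0∞)) ≤ (orderAt Z F z : ℝ≥0∞) := by
  obtain ⟨U, g, hU, hg, heq⟩ := exists_analyticOrderAt_eq_orderAt hZ
  obtain ⟨ρ, hρ, h⟩ := exists_eventually_tsum_analyticOrderAt_evalAt_eq hS hf hF hc hz hU g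
    (heq ▸ hZ)
  refine ⟨ρ, hρ, fun δ hδ hδρ ↦ (h δ hδ hδρ).mono fun n hn ↦ ?_⟩
  rw [← heq, ← hn.2]
  refine ENNReal.tsum_le_tsum fun w ↦ ?_
  exact_mod_cast orderAt_le_analyticOrderAt Z (f n) (hn.1 w w.2).2 hg

/-- `Z` is defined by one equation near every point. -/
def IsLocallyPrincipal (Z : X.IdealSheafData) : Prop :=
  ∀ x : X, ∃ (U : X.affineOpens) (g : Γ(X, U.1)), x ∈ U.1 ∧ Z.ideal U = Ideal.span {g}

/-- A local generator computes the order for `F` and for every `f n` alike, so Hurwitz gives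
equality. -/
theorem exists_eventually_tsum_orderAt_eq {f : ℕ → ℂ → CPoint X}
    {F : ℂ → CPoint X} {S : Set ℂ} (hS : IsOpen S) (hf : ∀ᶠ n in atTop, IsHolomorphicOn (f n) S)
    (hF : IsHolomorphicOn F S) (hc : ∀ z ∈ S, ConvergesAt f F z) {Z : X.IdealSheafData}
    (hprin : IsLocallyPrincipal Z) {z : ℂ} (hz : z ∈ S) (hZ : orderAt Z F z ≠ ⊤) :
    ∃ ρ > 0, ∀ δ, 0 < δ → δ < ρ → ∀ᶠ n in atTop,
      (∑' w : ball z δ, (orderAt Z (f n) w : ℝ≥0∞)) = (orderAt Z F z : ℝ≥0∞) := by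
  obtain ⟨U, g, hU, hg⟩ := hprin (F z).pt
  have heq := orderAt_principal Z U g hg F S hS hF z hz hU
  obtain ⟨ρ, hρ, h⟩ := exists_eventually_tsum_analyticOrderAt_evalAt_eq hS hf hF hc hz hU g
    (heq ▸ hZ)
  refine ⟨ρ, hρ, fun δ hδ hδρ ↦ ((h δ hδ hδρ).and hf).mono fun n hn ↦ ?_⟩
  rw [heq, ← hn.1.2]
  refine tsum_congr fun w ↦ ?_
  rw [orderAt_principal Z U g hg (f n) S hS hn.2 w (hn.1.1 w w.2).1 (hn.1.1 w w.2).2]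

/-- Finite order makes contact points isolated; compactness induction then bounds their number on
`K`. -/
theorem finite_setOf_pt_mem_support {F : ℂ → CPoint X} {S : Set ℂ} (hS : IsOpen S)
    (hF : IsHolomorphicOn F S) {Z : X.IdealSheafData} (hZ : ∀ z ∈ S, orderAt Z F z ≠ ⊤)
    {K : Set ℂ} (hK : IsCompact K) (hKS : K ⊆ S) : {z ∈ K | (F z).pt ∈ Z.support}.Finite := by
  refine hK.induction_on (p := fun s ↦ {z ∈ s | (F z).pt ∈ Z.support}.Finite) (by simp)
    (fun s t hst ht ↦ ht.subset fun z hz ↦ ⟨hst hz.1, hz.2⟩)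
    (fun s t hs ht ↦ (hs.union ht).subset fun z hz ↦ hz.1.imp (⟨·, hz.2⟩) (⟨·, hz.2⟩))
    fun z hz ↦ ?_
  have h1 := eventually_nhdsWithin_iff.1
    (hF.eventually_notMem_support hS (hKS hz) (hZ z (hKS hz)))
  refine ⟨_, mem_nhdsWithin_of_mem_nhds h1, (Set.finite_singleton z).subset fun w hw ↦ ?_⟩
  by_contra hne
  exact hw.1 hne hw.2

end Counting

/-! ### Contact points in a disc. -/

section ZeroCount

open Metric

variable {X : Scheme.{0}} [X.Over (Spec (CommRingCat.of ℂ))]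

/-- The number of intersections of `f` with `Z` in the disc of radius `t`, with multiplicities. -/
noncomputable def zeroCount (Z : X.IdealSheafData) (f : ℂ → CPoint X) (t : ℝ) : ℝ≥0∞ :=
  ∑' z : ball (0 : ℂ) t, (orderAt Z f z : ℝ≥0∞)

theorem monotone_zeroCount (Z : X.IdealSheafData) (f : ℂ → CPoint X) :
    Monotone (zeroCount Z f) := fun _ _ h ↦
  ENNReal.tsum_mono_subtype (fun z ↦ (orderAt Z f z : ℝ≥0∞)) (ball_subset_ball h)

/-- Each requirement holds for all small `δ > 0`, and there are finitely many of them. -/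
theorem exists_pairwiseDisjoint_balls {ι : Set ℂ} (hι : ι.Finite) {B : Set ℂ} (hB : IsOpen B)
    (hιB : ι ⊆ B) (ρ : ℂ → ℝ) (hρ : ∀ z ∈ ι, 0 < ρ z) :
    ∃ δ > 0, (∀ z ∈ ι, δ < ρ z) ∧ (∀ z ∈ ι, ball z δ ⊆ B) ∧
      ι.PairwiseDisjoint (fun z ↦ ball z δ) := by
  have h1 : ∀ z ∈ ι, ∀ᶠ δ in 𝓝[>] (0 : ℝ), δ < ρ z ∧ ball z δ ⊆ B := by
    intro z hz
    obtain ⟨ε, hε, hεB⟩ := Metric.isOpen_iff.1 hB z (hιB hz)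
    filter_upwards [mem_nhdsWithin_of_mem_nhds (Iio_mem_nhds (hρ z hz)),
      mem_nhdsWithin_of_mem_nhds (Iio_mem_nhds hε)] with δ h1 h2
    exact ⟨h1, (ball_subset_ball (le_of_lt h2)).trans hεB⟩
  have h2 : ∀ z ∈ ι, ∀ w ∈ ι, ∀ᶠ δ in 𝓝[>] (0 : ℝ), z ≠ w → Disjoint (ball z δ) (ball w δ) := by
    intro z _ w _
    by_cases h : z = w
    · exact Eventually.of_forall fun _ h' ↦ absurd h h'
    · filter_upwards [mem_nhdsWithin_of_mem_nhds (Iio_mem_nhds (half_pos (dist_pos.2 h)))]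
        with δ hδ _
      refine ball_disjoint_ball ?_
      have : δ < dist z w / 2 := hδ
      linarith
  have h3 := ((eventually_all_finite hι).2 h1).and
    ((eventually_all_finite hι).2 fun z hz ↦ (eventually_all_finite hι).2 (h2 z hz))
  obtain ⟨δ, ⟨h4, h5⟩, h6⟩ := (h3.and self_mem_nhdsWithin).exists
  exact ⟨δ, h6, fun z hz ↦ (h4 z hz).1, fun z hz ↦ (h4 z hz).2,
    fun z hz w hw hzw ↦ h5 z hz w hw hzw⟩

theorem tsum_ball_eq_sum {o : ℂ → ℝ≥0∞} {s : Finset ℂ} {B : Set ℂ} {δ : ℝ}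
    (hB : ∀ z ∈ s, ball z δ ⊆ B) (hdisj : (s : Set ℂ).PairwiseDisjoint (fun z ↦ ball z δ))
    (h0 : ∀ w ∈ B, (∀ z ∈ s, w ∉ ball z δ) → o w = 0) :
    ∑' w : B, o w = ∑ z ∈ s, ∑' w : ball z δ, o w := by
  have h1 := ENNReal.tsum_biUnion' (f := o) hdisj
  rw [s.tsum_subtype' (fun z ↦ ∑' w : ball z δ, o w)] at h1
  rw [← h1, tsum_subtype, tsum_subtype]
  refine tsum_congr fun w ↦ ?_
  by_cases hw : w ∈ ⋃ z ∈ (s : Set ℂ), ball z δ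
  · rw [Set.indicator_of_mem hw]
    obtain ⟨z, hz, hwz⟩ := Set.mem_iUnion₂.1 hw
    exact Set.indicator_of_mem (hB z hz hwz) o
  · rw [Set.indicator_of_notMem hw]
    by_cases hwB : w ∈ B
    · rw [Set.indicator_of_mem hwB]
      exact h0 w hwB fun z hz hwz ↦ hw (Set.mem_iUnion₂.2 ⟨z, hz, hwz⟩)
    · exact Set.indicator_of_notMem hwB o

variable {f : ℕ → ℂ → CPoint X} {F : ℂ → CPoint X} {S : Set ℂ}

theorem IsHolomorphicOn.zeroCount_eq_sum (hS : IsOpen S) (hF : IsHolomorphicOn F S)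
    {Z : X.IdealSheafData} {t : ℝ} (htS : closedBall 0 t ⊆ S) {s : Finset ℂ}
    (hs : ∀ z, z ∈ s ↔ z ∈ ball 0 t ∧ (F z).pt ∈ Z.support) :
    zeroCount Z F t = ∑ z ∈ s, (orderAt Z F z : ℝ≥0∞) := by
  rw [zeroCount, tsum_subtype (ball 0 t) (fun z ↦ (orderAt Z F z : ℝ≥0∞)), tsum_eq_sum (s := s)]
  · exact Finset.sum_congr rfl fun z hz ↦ Set.indicator_of_mem ((hs z).1 hz).1 _
  · intro z hz
    by_cases hzt : z ∈ ball 0 t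
    · rw [Set.indicator_of_mem hzt, hF.orderAt_eq_zero hS (htS (ball_subset_closedBall hzt))
        fun h ↦ hz ((hs z).2 ⟨hzt, h⟩)]
      simp
    · exact Set.indicator_of_notMem hzt _

theorem IsHolomorphicOn.zeroCount_ne_top (hS : IsOpen S) (hF : IsHolomorphicOn F S)
    {Z : X.IdealSheafData} (hZ : ∀ z ∈ S, orderAt Z F z ≠ ⊤) {t : ℝ} (htS : closedBall 0 t ⊆ S) :
    zeroCount Z F t ≠ ⊤ := by
  have hfin := (finite_setOf_pt_mem_support hS hF hZ (isCompact_closedBall 0 t) htS).subset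
    (t := {z ∈ ball 0 t | (F z).pt ∈ Z.support}) fun z hz ↦ ⟨ball_subset_closedBall hz.1, hz.2⟩
  rw [hF.zeroCount_eq_sum hS htS (s := hfin.toFinset) (fun z ↦ hfin.mem_toFinset)]
  refine ENNReal.sum_ne_top.2 fun z hz ↦ ?_
  have := hZ z (htS (ball_subset_closedBall (hfin.mem_toFinset.1 hz).1))
  obtain ⟨k, hk⟩ := ENat.ne_top_iff_exists.1 this
  rw [← hk]
  simp

/-- If `F` meets `Z` nowhere on the circle of radius `t`, the intersections of `f n` with `Z` in the
disc gather, for large `n`, in small discs about those of `F`. -/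
theorem exists_eventually_zeroCount_eq_sum (hS : IsOpen S)
    (hf : ∀ᶠ n in atTop, IsHolomorphicOn (f n) S) (hF : IsHolomorphicOn F S)
    (hc : ∀ z ∈ S, ConvergesAt f F z) {Z : X.IdealSheafData} (hZ : ∀ z ∈ S, orderAt Z F z ≠ ⊤)
    {t : ℝ} (htS : closedBall 0 t ⊆ S) (ht : ∀ z : ℂ, ‖z‖ = t → (F z).pt ∉ Z.support)
    (ρ : ℂ → ℝ) (hρ : ∀ z ∈ S, 0 < ρ z) :
    ∃ (s : Finset ℂ) (δ : ℝ), 0 < δ ∧ (∀ z ∈ s, z ∈ S ∧ δ < ρ z) ∧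
      zeroCount Z F t = ∑ z ∈ s, (orderAt Z F z : ℝ≥0∞) ∧
      ∀ᶠ n in atTop, zeroCount Z (f n) t =
        ∑ z ∈ s, ∑' w : ball z δ, (orderAt Z (f n) w : ℝ≥0∞) := by
  have hfin := finite_setOf_pt_mem_support hS hF hZ (isCompact_closedBall 0 t) htS
  have hball : ∀ z ∈ closedBall (0 : ℂ) t, (F z).pt ∈ Z.support → z ∈ ball 0 t := by
    intro z hz hzZ
    rw [mem_ball_zero_iff]
    exact lt_of_le_of_ne (mem_closedBall_zero_iff.1 hz) fun h ↦ ht z h hzZ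
  obtain ⟨δ, hδ, h1, h2, h3⟩ := exists_pairwiseDisjoint_balls hfin isOpen_ball
    (fun z hz ↦ hball z hz.1 hz.2) ρ fun z hz ↦ hρ z (htS hz.1)
  have hs : ∀ z, z ∈ hfin.toFinset ↔ z ∈ ball 0 t ∧ (F z).pt ∈ Z.support := fun z ↦
    hfin.mem_toFinset.trans ⟨fun h ↦ ⟨hball z h.1 h.2, h.2⟩,
      fun h ↦ ⟨ball_subset_closedBall h.1, h.2⟩⟩
  refine ⟨hfin.toFinset, δ, hδ, fun z hz ↦ ?_, hF.zeroCount_eq_sum hS htS hs, ?_⟩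
  · have hz' := hfin.mem_toFinset.1 hz
    exact ⟨htS hz'.1, h1 z hz'⟩
  -- On this compact remainder `F` avoids `Z`, hence so does `f n` for large `n`.
  have hK : IsCompact (closedBall (0 : ℂ) t \ ⋃ z ∈ hfin.toFinset, ball z δ) :=
    (isCompact_closedBall 0 t).diff (isOpen_biUnion fun _ _ ↦ isOpen_ball)
  filter_upwards [hf, eventually_forall_notMem_support (Z := Z) hK (fun z hz ↦ hc z (htS hz.1))
    fun z hz hzZ ↦ hz.2 (Set.mem_iUnion₂.2 ⟨z, hfin.mem_toFinset.2 ⟨hz.1, hzZ⟩,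
      mem_ball_self hδ⟩)] with n hn hnK
  refine tsum_ball_eq_sum (o := fun w ↦ (orderAt Z (f n) w : ℝ≥0∞))
    (fun z hz ↦ h2 z (hfin.mem_toFinset.1 hz))
    (by simpa only [hfin.coe_toFinset] using h3) fun w hw hw' ↦ ?_
  have hwt := ball_subset_closedBall hw
  rw [hn.orderAt_eq_zero hS (htS hwt) (hnK w ⟨hwt, fun h ↦ ?_⟩)]
  · simp
  · obtain ⟨z, hz, hwz⟩ := Set.mem_iUnion₂.1 h
    exact hw' z hz hwz

theorem eventually_zeroCount_le (hS : IsOpen S)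
    (hf : ∀ᶠ n in atTop, IsHolomorphicOn (f n) S) (hF : IsHolomorphicOn F S)
    (hc : ∀ z ∈ S, ConvergesAt f F z) {Z : X.IdealSheafData} (hZ : ∀ z ∈ S, orderAt Z F z ≠ ⊤)
    {t : ℝ} (htS : closedBall 0 t ⊆ S) (ht : ∀ z : ℂ, ‖z‖ = t → (F z).pt ∉ Z.support) :
    ∀ᶠ n in atTop, zeroCount Z (f n) t ≤ zeroCount Z F t := by
  choose! ρ hρ h using fun z hz ↦ exists_eventually_tsum_orderAt_le hS hf hF hc hz (hZ z hz)
  obtain ⟨s, δ, hδ, hs, hsum, hev⟩ := exists_eventually_zeroCount_eq_sum hS hf hF hc hZ htS ht ρ hρ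
  filter_upwards [hev, (eventually_all_finset s).2
    fun z hz ↦ h z (hs z hz).1 δ hδ (hs z hz).2] with n hn hn'
  rw [hn, hsum]
  exact Finset.sum_le_sum hn'

theorem eventually_zeroCount_eq (hS : IsOpen S)
    (hf : ∀ᶠ n in atTop, IsHolomorphicOn (f n) S) (hF : IsHolomorphicOn F S)
    (hc : ∀ z ∈ S, ConvergesAt f F z) {Z : X.IdealSheafData} (hprin : IsLocallyPrincipal Z)
    (hZ : ∀ z ∈ S, orderAt Z F z ≠ ⊤)
    {t : ℝ} (htS : closedBall 0 t ⊆ S) (ht : ∀ z : ℂ, ‖z‖ = t → (F z).pt ∉ Z.support) :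
    ∀ᶠ n in atTop, zeroCount Z (f n) t = zeroCount Z F t := by
  choose! ρ hρ h using fun z hz ↦ exists_eventually_tsum_orderAt_eq hS hf hF hc hprin hz (hZ z hz)
  obtain ⟨s, δ, hδ, hs, hsum, hev⟩ := exists_eventually_zeroCount_eq_sum hS hf hF hc hZ htS ht ρ hρ
  filter_upwards [hev, (eventually_all_finset s).2
    fun z hz ↦ h z (hs z hz).1 δ hδ (hs z hz).2] with n hn hn'
  rw [hn, hsum]
  exact Finset.sum_congr rfl hn'

end ZeroCount

/-! ### Limits and semicontinuity of counting functions. -/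

section CountingLimit

open Metric Set

variable {X : Scheme.{0}} [X.Over (Spec (CommRingCat.of ℂ))]
  {f : ℕ → ℂ → CPoint X} {F : ℂ → CPoint X}

theorem counting_eq (Z : X.IdealSheafData) (f : ℂ → CPoint X) (r : ℝ) :
    counting Z f r = ∫ t in (1 : ℝ)..r, (zeroCount Z f t).toReal / t := rfl

theorem measurable_zeroCount_div (Z : X.IdealSheafData) (f : ℂ → CPoint X) :
    Measurable fun t ↦ (zeroCount Z f t).toReal / t :=
  (monotone_zeroCount Z f).measurable.ennreal_toReal.div measurable_id

theorem norm_zeroCount_div_le {Z : X.IdealSheafData} {f : ℂ → CPoint X} {M : ℝ≥0∞} (hM : M ≠ ⊤)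
    {a b t : ℝ} (ha : 0 < a) (hat : a ≤ t) (htb : t ≤ b) (hb : zeroCount Z f b ≤ M) :
    ‖(zeroCount Z f t).toReal / t‖ ≤ M.toReal / a := by
  rw [Real.norm_of_nonneg (div_nonneg ENNReal.toReal_nonneg (ha.le.trans hat))]
  have := ENNReal.toReal_mono hM ((monotone_zeroCount Z f htb).trans hb)
  gcongr

theorem intervalIntegrable_zeroCount_div {Z : X.IdealSheafData} {f : ℂ → CPoint X} {a b c : ℝ}
    (ha : 0 < a) (hc : zeroCount Z f c ≠ ⊤) (hac : a ≤ c) (hb : 0 < b) (hbc : b ≤ c) :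
    IntervalIntegrable (fun t ↦ (zeroCount Z f t).toReal / t) volume a b := by
  refine (intervalIntegrable_const (c := (zeroCount Z f c).toReal / min a b)).mono_fun
    (measurable_zeroCount_div Z f).aestronglyMeasurable ?_
  filter_upwards [ae_restrict_mem measurableSet_uIoc] with t ht
  refine (norm_zeroCount_div_le hc (lt_min ha hb) ht.1.le (ht.2.trans (max_le hac hbc))
    le_rfl).trans (le_abs_self _)

variable {ρ : ℝ}

theorem exists_forall_norm_eq_notMem_support (hF : IsHolomorphicOn F (ball 0 ρ))
    {Z : X.IdealSheafData} (hZ : ∀ z ∈ ball 0 ρ, orderAt Z F z ≠ ⊤) {b : ℝ} (hb : b < ρ) :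
    ∃ c, b < c ∧ c < ρ ∧ ∀ z : ℂ, ‖z‖ = c → (F z).pt ∉ Z.support := by
  obtain ⟨b', hb', hb'ρ⟩ := exists_between hb
  have hfin := (finite_setOf_pt_mem_support isOpen_ball hF hZ (isCompact_closedBall 0 b')
    (closedBall_subset_ball hb'ρ)).image norm
  obtain ⟨c, hc, hc'⟩ := (Ioo_infinite hb').exists_notMem_finite hfin
  refine ⟨c, hc.1, hc.2.trans hb'ρ, fun z hz hzZ ↦ hc' ⟨z, ⟨?_, hzZ⟩, hz⟩⟩
  rw [mem_closedBall_zero_iff, hz]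
  exact hc.2.le

theorem ae_forall_norm_eq_notMem_support (hF : IsHolomorphicOn F (ball 0 ρ))
    {Z : X.IdealSheafData} (hZ : ∀ z ∈ ball 0 ρ, orderAt Z F z ≠ ⊤) {b : ℝ} (hb : b < ρ) :
    ∀ᵐ t : ℝ, t ≤ b → ∀ z : ℂ, ‖z‖ = t → (F z).pt ∉ Z.support := by
  have hfin := (finite_setOf_pt_mem_support isOpen_ball hF hZ (isCompact_closedBall 0 b)
    (closedBall_subset_ball hb)).image norm
  filter_upwards [measure_eq_zero_iff_ae_notMem.1 (hfin.measure_zero volume)] with t ht htb z hz hzZ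
  refine ht ⟨z, ⟨?_, hzZ⟩, hz⟩
  rw [mem_closedBall_zero_iff, hz]
  exact htb

/-- The dominating constant. The circle of radius `b` may meet `Z`, so the count is bounded on a
slightly larger disc whose boundary circle does not. -/
theorem exists_eventually_zeroCount_le (hf : ∀ᶠ n in atTop, IsHolomorphicOn (f n) (ball 0 ρ))
    (hF : IsHolomorphicOn F (ball 0 ρ)) (hc : ∀ z ∈ ball 0 ρ, ConvergesAt f F z)
    {Z : X.IdealSheafData} (hZ : ∀ z ∈ ball 0 ρ, orderAt Z F z ≠ ⊤) {b : ℝ} (hb : b < ρ) :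
    ∃ M : ℝ≥0∞, M ≠ ⊤ ∧ zeroCount Z F b ≤ M ∧ ∀ᶠ n in atTop, zeroCount Z (f n) b ≤ M := by
  obtain ⟨c, hbc, hcρ, hcZ⟩ := exists_forall_norm_eq_notMem_support hF hZ hb
  refine ⟨zeroCount Z F c, hF.zeroCount_ne_top isOpen_ball hZ (closedBall_subset_ball hcρ),
    monotone_zeroCount Z F hbc.le, ?_⟩
  filter_upwards [eventually_zeroCount_le isOpen_ball hf hF hc hZ (closedBall_subset_ball hcρ) hcZ]
    with n hn
  exact (monotone_zeroCount Z (f n) hbc.le).trans hn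

theorem tendsto_counting (hf : ∀ᶠ n in atTop, IsHolomorphicOn (f n) (ball 0 ρ))
    (hF : IsHolomorphicOn F (ball 0 ρ)) (hc : ∀ z ∈ ball 0 ρ, ConvergesAt f F z)
    {Z : X.IdealSheafData} (hprin : IsLocallyPrincipal Z)
    (hZ : ∀ z ∈ ball 0 ρ, orderAt Z F z ≠ ⊤) {r : ℝ} (hr : 0 < r) (hrρ : r < ρ) (hρ : 1 < ρ) :
    Tendsto (fun n ↦ counting Z (f n) r) atTop (𝓝 (counting Z F r)) := by
  -- Here `r < 1` is allowed, so the range of integration lies between `min 1 r` and `max 1 r`.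
  obtain ⟨M, hM, -, hfM⟩ := exists_eventually_zeroCount_le hf hF hc hZ (max_lt hρ hrρ)
  simp only [counting_eq]
  refine intervalIntegral.tendsto_integral_filter_of_dominated_convergence
    (fun _ ↦ M.toReal / min 1 r)
    (Eventually.of_forall fun n ↦ (measurable_zeroCount_div Z (f n)).aestronglyMeasurable)
    ?_ intervalIntegrable_const ?_
  · filter_upwards [hfM] with n hn
    exact Eventually.of_forall fun t ht ↦
      norm_zeroCount_div_le hM (lt_min one_pos hr) ht.1.le ht.2 hn
  · filter_upwards [ae_forall_norm_eq_notMem_support hF hZ (max_lt hρ hrρ)] with t ht htr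
    refine tendsto_const_nhds.congr' ?_
    filter_upwards [eventually_zeroCount_eq isOpen_ball hf hF hc hprin hZ
      (closedBall_subset_ball (htr.2.trans_lt (max_lt hρ hrρ))) (ht htr.2)] with n hn
    rw [hn]

theorem counting_nonneg (Z : X.IdealSheafData) (f : ℂ → CPoint X) {r : ℝ} (hr : 1 ≤ r) :
    0 ≤ counting Z f r :=
  intervalIntegral.integral_nonneg hr fun _ ht ↦
    div_nonneg ENNReal.toReal_nonneg (zero_le_one.trans ht.1)

/-- The counting function is upper semicontinuous under locally uniform convergence. -/
theorem eventually_counting_lt (hf : ∀ᶠ n in atTop, IsHolomorphicOn (f n) (ball 0 ρ))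
    (hF : IsHolomorphicOn F (ball 0 ρ)) (hc : ∀ z ∈ ball 0 ρ, ConvergesAt f F z)
    {Z : X.IdealSheafData} (hZ : ∀ z ∈ ball 0 ρ, orderAt Z F z ≠ ⊤) {r : ℝ} (hr : 1 ≤ r)
    (hrρ : r < ρ) {C : ℝ} (hC : counting Z F r < C) :
    ∀ᶠ n in atTop, counting Z (f n) r < C := by
  obtain ⟨M, hM, hFM, hfM⟩ := exists_eventually_zeroCount_le hf hF hc hZ hrρ
  have hbound : ∀ u : ℂ → CPoint X, zeroCount Z u r ≤ M → ∀ t ∈ uIoc 1 r,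
      ‖(zeroCount Z u t).toReal / t‖ ≤ M.toReal / 1 := fun u hu t ht ↦ by
    rw [uIoc_of_le hr] at ht
    exact norm_zeroCount_div_le hM one_pos ht.1.le ht.2 hu
  have hmeas : ∀ n, Measurable fun t ↦
      max ((zeroCount Z (f n) t).toReal / t) ((zeroCount Z F t).toReal / t) := fun n ↦
    (measurable_zeroCount_div Z (f n)).max (measurable_zeroCount_div Z F)
  have hmaxle : ∀ n, zeroCount Z (f n) r ≤ M → ∀ t ∈ uIoc 1 r,
      ‖max ((zeroCount Z (f n) t).toReal / t) ((zeroCount Z F t).toReal / t)‖ ≤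
        M.toReal / 1 := fun n hn t ht ↦
    (abs_max_le_max_abs_abs).trans (max_le (hbound (f n) hn t ht) (hbound F hFM t ht))
  -- Taking the maximum with the limit integrand turns the eventual inequality of counts into
  -- pointwise convergence, so dominated convergence serves as a reverse Fatou lemma.
  have hlim : Tendsto (fun n ↦ ∫ t in (1 : ℝ)..r,
      max ((zeroCount Z (f n) t).toReal / t) ((zeroCount Z F t).toReal / t)) atTop
      (𝓝 (counting Z F r)) := by
    rw [counting_eq]
    refine intervalIntegral.tendsto_integral_filter_of_dominated_convergence
      (fun _ ↦ M.toReal / 1) (Eventually.of_forall fun n ↦ (hmeas n).aestronglyMeasurable)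
      ?_ intervalIntegrable_const ?_
    · filter_upwards [hfM] with n hn
      exact Eventually.of_forall (hmaxle n hn)
    · filter_upwards [ae_forall_norm_eq_notMem_support hF hZ hrρ] with t ht htr
      rw [uIoc_of_le hr] at htr
      have htρ : closedBall (0 : ℂ) t ⊆ ball 0 ρ := closedBall_subset_ball (htr.2.trans_lt hrρ)
      refine tendsto_const_nhds.congr' ?_
      filter_upwards [eventually_zeroCount_le isOpen_ball hf hF hc hZ htρ (ht htr.2)] with n hn
      refine (max_eq_right ?_).symm
      have := ENNReal.toReal_mono (hF.zeroCount_ne_top isOpen_ball hZ htρ) hn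
      have := zero_le_one.trans htr.1.le
      gcongr
  filter_upwards [hlim.eventually_lt_const hC, hfM] with n hn hnM
  refine lt_of_le_of_lt ?_ hn
  have hint : IntervalIntegrable (fun t ↦
      max ((zeroCount Z (f n) t).toReal / t) ((zeroCount Z F t).toReal / t)) volume 1 r := by
    refine (intervalIntegrable_const (c := M.toReal / 1)).mono_fun
      (hmeas n).aestronglyMeasurable ?_
    filter_upwards [ae_restrict_mem measurableSet_uIoc] with t ht
    exact (hmaxle n hnM t ht).trans (le_abs_self _)
  exact intervalIntegral.integral_mono_on hr (intervalIntegrable_zeroCount_div one_pos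
    (ne_top_of_le_ne_top hM hnM) hr (one_pos.trans_le hr) le_rfl) hint fun t _ ↦ le_max_left _ _

theorem counting_pos (hF : IsHolomorphicOn F (ball 0 ρ)) {Z : X.IdealSheafData}
    (hZ : ∀ z ∈ ball 0 ρ, orderAt Z F z ≠ ⊤) {r : ℝ} (hr : 1 < r) (hrρ : r < ρ)
    (h : ∃ z : ℂ, ‖z‖ < r ∧ (F z).pt ∈ Z.support) : 0 < counting Z F r := by
  obtain ⟨z, hz, hzZ⟩ := h
  have htop : ∀ t ≤ r, zeroCount Z F t ≠ ⊤ := fun t ht ↦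
    hF.zeroCount_ne_top isOpen_ball hZ (closedBall_subset_ball (ht.trans_lt hrρ))
  -- For `t ≥ m` the disc contains `z`, so the integrand is at least `1 / r` on `[m, r]`, an
  -- interval of positive length.
  obtain ⟨m, hm, hmr⟩ := exists_between (max_lt hr hz)
  obtain ⟨hm1, hmz⟩ := max_lt_iff.1 hm
  have hm0 := one_pos.trans hm1
  have hr0 := one_pos.trans hr
  have hone : ∀ t, m ≤ t → 1 ≤ zeroCount Z F t := by
    intro t ht
    have h1 := ENNReal.le_tsum (f := fun z : ball (0 : ℂ) t ↦ (orderAt Z F z : ℝ≥0∞))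
      ⟨z, mem_ball_zero_iff.2 (hmz.trans_le ht)⟩
    refine le_trans ?_ h1
    exact_mod_cast hF.one_le_orderAt isOpen_ball (mem_ball_zero_iff.2 (hz.trans hrρ)) hzZ
  rw [counting_eq, ← intervalIntegral.integral_add_adjacent_intervals (b := m)
    (intervalIntegrable_zeroCount_div one_pos (htop m hmr.le) hm1.le hm0 le_rfl)
    (intervalIntegrable_zeroCount_div hm0 (htop r le_rfl) hmr.le hr0 le_rfl)]
  refine add_pos_of_nonneg_of_pos (counting_nonneg Z F hm1.le) ?_
  have h2 : ∫ _ in m..r, 1 / r ≤ ∫ t in m..r, (zeroCount Z F t).toReal / t := by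
    refine intervalIntegral.integral_mono_on hmr.le intervalIntegrable_const
      (intervalIntegrable_zeroCount_div hm0 (htop r le_rfl) hmr.le hr0 le_rfl) fun t ht ↦ ?_
    have ht0 := hm0.trans_le ht.1
    have h3 : 1 ≤ (zeroCount Z F t).toReal := by
      simpa using ENNReal.toReal_mono (htop t ht.2) (hone t ht.1)
    have h4 := ht.2
    gcongr
  refine lt_of_lt_of_le ?_ h2
  rw [intervalIntegral.integral_const, smul_eq_mul]
  have := sub_pos.2 hmr
  positivity

theorem eventually_counting_le_two_mul
    (hf : ∀ᶠ n in atTop, IsHolomorphicOn (f n) (ball 0 ρ))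
    (hF : IsHolomorphicOn F (ball 0 ρ)) (hc : ∀ z ∈ ball 0 ρ, ConvergesAt f F z)
    {Z : X.IdealSheafData} (hZ : ∀ z ∈ ball 0 ρ, orderAt Z F z ≠ ⊤) {r : ℝ} (hr : 1 ≤ r)
    (hrρ : r < ρ) (h : (∀ z : ℂ, ‖z‖ = r → (F z).pt ∉ Z.support) ∨
      ∃ z : ℂ, ‖z‖ < r ∧ (F z).pt ∈ Z.support) :
    ∀ᶠ n in atTop, counting Z (f n) r ≤ 2 * counting Z F r := by
  by_cases hin : ∃ z : ℂ, ‖z‖ < r ∧ (F z).pt ∈ Z.support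
  · rcases hr.eq_or_lt with rfl | hr1
    -- For `r = 1` both integrals run over a degenerate interval.
    · simp [counting]
    · have hpos := counting_pos hF hZ hr1 hrρ hin
      exact (eventually_counting_lt hf hF hc hZ hr hrρ (by linarith)).mono fun n hn ↦ hn.le
  -- Now `F` avoids `Z` on the whole closed disc, so the count of `f n` vanishes for large `n`.
  · have hcirc := h.resolve_right hin
    push Not at hin
    have hr0 : closedBall (0 : ℂ) r ⊆ ball 0 ρ := closedBall_subset_ball hrρ
    filter_upwards [hf, eventually_forall_notMem_support (Z := Z) (isCompact_closedBall 0 r)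
      (fun z hz ↦ hc z (hr0 hz)) fun z hz ↦ by
        rcases (mem_closedBall_zero_iff.1 hz).eq_or_lt with h | h
        · exact hcirc z h
        · exact hin z h] with n hn hnZ
    have h0 : ∀ t ∈ uIcc 1 r, (zeroCount Z (f n) t).toReal / t = 0 := by
      intro t ht
      rw [uIcc_of_le hr] at ht
      have : zeroCount Z (f n) t = 0 := by
        refine ENNReal.tsum_eq_zero.2 fun z ↦ ?_
        have hz : (z : ℂ) ∈ closedBall 0 r :=
          closedBall_subset_closedBall ht.2 (ball_subset_closedBall z.2)
        rw [hn.orderAt_eq_zero isOpen_ball (hr0 hz) (hnZ z hz)]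
        simp
      simp [this]
    rw [counting_eq, intervalIntegral.integral_congr h0]
    have := counting_nonneg Z F hr
    simpa using this

end CountingLimit

/-! ### Laplacian of a smooth function along a holomorphic map. -/

section Laplacian

variable {E : Type*} [NormedAddCommGroup E] [NormedSpace ℂ E]

/-- The Levi form of `Ψ` at `p`, up to normalization: the Laplacian at `0` of
`t ↦ Ψ (p + t • q)`. -/
noncomputable def leviForm (Ψ : E → ℝ) (p q : E) : ℝ :=
  fderiv ℝ (fderiv ℝ Ψ) p q q +
    fderiv ℝ (fderiv ℝ Ψ) p (Complex.I • q) (Complex.I • q)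

theorem continuousAt_leviForm {Ψ : E → ℝ} {p : E} (hΨ : ContDiffAt ℝ 2 Ψ p) (q : E) :
    ContinuousAt (fun x : E × E ↦ leviForm Ψ x.1 x.2) (p, q) := by
  have h1 : ContinuousAt (fderiv ℝ (fderiv ℝ Ψ)) p :=
    ((hΨ.fderiv_right (m := 1) le_rfl).fderiv_right (m := 0) (by simp)).continuousAt
  have h2 : ContinuousAt (fun x : E × E ↦ fderiv ℝ (fderiv ℝ Ψ) x.1) (p, q) :=
    ContinuousAt.comp (f := Prod.fst) h1 continuousAt_fst
  have h3 : ContinuousAt (fun x : E × E ↦ x.2) (p, q) := continuousAt_snd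
  have h4 : ContinuousAt (fun x : E × E ↦ Complex.I • x.2) (p, q) := h3.const_smul _
  exact ((h2.clm_apply h3).clm_apply h3).add ((h2.clm_apply h4).clm_apply h4)

/-- In the second-order chain rule the terms with `G''` carry the factors `1² = 1` and `I² = -1` in
the two coordinate directions and cancel, leaving only first derivatives of `G`. -/
theorem laplacian_comp_eq_leviForm {Ψ : E → ℝ} {G : ℂ → E} {z : ℂ} [CompleteSpace E]
    (hΨ : ContDiffAt ℝ 2 Ψ (G z)) (hG : AnalyticAt ℂ G z) :
    Laplacian.laplacian (fun w ↦ Ψ (G w)) z = leviForm Ψ (G z) (deriv G z) := by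
  let ℓ : E →L[ℝ] ℂ →L[ℝ] E := (ContinuousLinearMap.lsmul ℝ ℂ).flip
  have hℓ : ∀ x v, ℓ x v = v • x := fun x v ↦ rfl
  have hderiv : ∀ H : ℂ → E, ∀ w, DifferentiableAt ℂ H w → HasFDerivAt H (ℓ (deriv H w)) w := by
    intro H w hH
    refine (hH.hasDerivAt.hasFDerivAt.restrictScalars ℝ).congr_fderiv ?_
    ext v
    simp [hℓ]
  have hfst : fderiv ℝ (fun w ↦ Ψ (G w)) =ᶠ[𝓝 z]
      fun w ↦ (fderiv ℝ Ψ (G w)).comp (ℓ (deriv G w)) := by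
    have h1 : ∀ᶠ p in 𝓝 (G z), DifferentiableAt ℝ Ψ p :=
      (hΨ.eventually (by simp)).mono fun p hp ↦ hp.differentiableAt (by simp)
    filter_upwards [hG.continuousAt.eventually h1, hG.eventually_analyticAt] with w hw hw'
    exact (hw.hasFDerivAt.comp w (hderiv G w hw'.differentiableAt)).fderiv
  have hsnd := ((((hΨ.fderiv_right (m := 1) le_rfl).differentiableAt (by simp)).hasFDerivAt).comp z
    (hderiv G z hG.differentiableAt)).clm_comp
    (ℓ.hasFDerivAt.comp z (hderiv (deriv G) z hG.deriv.differentiableAt))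
  have hval : fderiv ℝ (fderiv ℝ (fun w ↦ Ψ (G w))) z = _ := hfst.fderiv_eq.trans hsnd.fderiv
  rw [InnerProductSpace.laplacian_eq_iteratedFDeriv_complexPlane]
  simp only [iteratedFDeriv_two_apply, hval, leviForm]
  simp [hℓ, smul_smul]
  ring

end Laplacian

/-! ### Convergence of the Chern densities. -/

section Chern

open Metric

variable {X : Scheme.{0}} [X.Over (Spec (CommRingCat.of ℂ))]

theorem laplacian_log_norm_eq_zero {a : ℂ → ℂ} {z : ℂ} (ha : AnalyticAt ℂ a z) (h0 : a z ≠ 0) :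
    ContDiffAt ℝ 2 (fun w ↦ Real.log ‖a w‖) z ∧
      Laplacian.laplacian (fun w ↦ Real.log ‖a w‖) z = 0 :=
  ⟨(ha.harmonicAt_log_norm h0).1, (ha.harmonicAt_log_norm h0).2.self_of_nhds⟩

/-- The Chern density can be computed in any local frame. -/
theorem chernDensity_eq_of_frame {L : LineBundle X} (h : HermitianMetric L) {f : ℂ → CPoint X}
    {S : Set ℂ} (hS : IsOpen S) (hf : IsHolomorphicOn f S) {z : ℂ} (hz : z ∈ S) {U : X.Opens}
    {e : Γ(L.sheaf, U)} (he : IsFrame L.sheaf e) (hU : (f z).pt ∈ U) {u : ℂ → ℝ}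
    (hu : ContDiffAt ℝ 2 u z) (heq : ∀ᶠ w in 𝓝 z, Real.log (h.norm U e (f w)) = u w) :
    chernDensity h f z = -(1 / (2 * Real.pi)) * Laplacian.laplacian u z := by
  obtain ⟨hV, he'⟩ := (L.exists_frame (f z).pt).choose_spec.choose_spec
  unfold chernDensity
  set V := (L.exists_frame (f z).pt).choose
  set e' : Γ(L.sheaf, V) := (L.exists_frame (f z).pt).choose_spec.choose
  obtain ⟨g, hg⟩ := h.exists_norm_frame_eq he he'
  have hUV : (f z).pt ∈ U ⊓ V := ⟨hU, hV⟩
  obtain ⟨hlog, hlap⟩ := laplacian_log_norm_eq_zero (hf.analyticAt hS hz hUV g) (hg (f z) hUV).1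
  -- A change of frame adds `log ‖g ∘ f‖` with `g ∘ f` holomorphic and nonvanishing, a harmonic
  -- function.
  have hsum : (fun w ↦ Real.log (h.norm V e' (f w))) =ᶠ[𝓝 z]
      (fun w ↦ Real.log ‖evalAt (U ⊓ V) g (f w)‖) + u := by
    filter_upwards [heq, hf.eventually_pt_mem hS hz hUV] with w hw hwUV
    obtain ⟨h0, h1⟩ := hg (f w) hwUV.2
    rw [h1, Real.log_mul (norm_ne_zero_iff.2 h0) (h.norm_pos e he _ hwUV.2.1).ne', hw]
    rfl
  rw [(InnerProductSpace.laplacian_congr_nhds hsum).self_of_nhds, hlog.laplacian_add hu, hlap,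
    zero_add]

/-- Near `F z` all densities are the same continuous function of `φ ∘ f n` and its derivative, and
both of these converge. -/
theorem convergesAt_chernDensity {L : LineBundle X} (h : HermitianMetric L)
    {f : ℕ → ℂ → CPoint X} {F : ℂ → CPoint X} {S : Set ℂ} (hS : IsOpen S)
    (hf : ∀ᶠ n in atTop, IsHolomorphicOn (f n) S) (hF : IsHolomorphicOn F S)
    (hc : ∀ z ∈ S, ConvergesAt f F z) {z : ℂ} (hz : z ∈ S) :
    ConvergesAt (fun n ↦ chernDensity h (f n)) (chernDensity h F) z := by
  obtain ⟨U, e, hU, he⟩ := L.exists_frame (F z).pt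
  obtain ⟨V, k, g, Φ, hV, hΦ, heq⟩ := h.smooth e he (F z) hU
  set φ : CPoint X → (Fin k → ℂ) := fun y i ↦ evalAt V (g i) y
  have hφ : ContinuousAt φ (F z) := continuousAt_pi.2 fun i ↦ continuousAt_evalAt (g i) hV
  have hΦz : 0 < Φ (φ (F z)) := by
    rw [← heq.self_of_nhds]
    exact pow_pos (h.norm_pos e he _ hU) 2
  have hgood : ∀ᶠ y in 𝓝 (F z), (y.pt ∈ U ∧ y.pt ∈ V) ∧ h.norm U e y ^ 2 = Φ (φ y) ∧
      0 < Φ (φ y) :=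
    ((eventually_pt_mem hU).and (eventually_pt_mem hV)).and
      (heq.and ((hΦ.continuous.continuousAt.comp hφ).eventually_const_lt hΦz))
  set Ψ : (Fin k → ℂ) → ℝ := fun p ↦ 1 / 2 * Real.log (Φ p)
  have hΨ : ∀ p, 0 < Φ p → ContDiffAt ℝ 2 Ψ p := fun p hp ↦
    contDiffAt_const.mul ((hΦ.contDiffAt.of_le (WithTop.coe_le_coe.2 le_top)).log hp.ne')
  obtain ⟨ρ, hρ, hρS, hFρ, hfρ⟩ := exists_ball_forall_of_eventually hS hF hz (hc z hz) hgood
  have hdiff : ∀ v : ℂ → CPoint X, IsHolomorphicOn v S → (∀ w ∈ ball z ρ, (v w).pt ∈ V) →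
      DifferentiableOn ℂ (fun w ↦ φ (v w)) (ball z ρ) := fun v hv hvV ↦
    differentiableOn_pi.2 fun i ↦ (hv.2 V (g i)).mono fun w hw ↦ ⟨hρS hw, hvV w hw⟩
  have hformula : ∀ v : ℂ → CPoint X, IsHolomorphicOn v S →
      (∀ w ∈ ball z ρ, ((v w).pt ∈ U ∧ (v w).pt ∈ V) ∧ h.norm U e (v w) ^ 2 = Φ (φ (v w)) ∧
        0 < Φ (φ (v w))) → ∀ w ∈ ball z ρ, chernDensity h v w =
        -(1 / (2 * Real.pi)) * leviForm Ψ (φ (v w)) (deriv (fun w ↦ φ (v w)) w) := by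
    intro v hv hvρ w hw
    have han : AnalyticAt ℂ (fun w ↦ φ (v w)) w :=
      (hdiff v hv fun w hw ↦ (hvρ w hw).1.2).analyticAt (isOpen_ball.mem_nhds hw)
    have hΨw := hΨ _ (hvρ w hw).2.2
    rw [← laplacian_comp_eq_leviForm hΨw han]
    refine chernDensity_eq_of_frame h hS hv (hρS hw) he (hvρ w hw).1.1
      (ContDiffAt.comp (g := Ψ) w hΨw ((han.restrictScalars (𝕜 := ℝ)).contDiffAt)) ?_
    filter_upwards [isOpen_ball.mem_nhds hw] with w' hw'
    simp [Ψ, ← (hvρ w' hw').2.1, Real.log_pow]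
  have hcφ : ∀ w ∈ ball z ρ, ConvergesAt (fun n w ↦ φ (f n w)) (fun w ↦ φ (F w)) w :=
    fun w hw ↦ (hc w (hρS hw)).comp
      (continuousAt_pi.2 fun i ↦ continuousAt_evalAt (g i) (hFρ w hw).1.2)
  have hdF := hdiff F hF fun w hw ↦ (hFρ w hw).1.2
  have hloc : TendstoLocallyUniformlyOn (fun n w ↦ φ (f n w)) (fun w ↦ φ (F w)) atTop
      (ball z ρ) := by
    rw [tendstoLocallyUniformlyOn_iff_forall_isCompact isOpen_ball]
    exact fun K hKρ hK ↦ tendstoUniformlyOn_of_convergesAt hK (fun w hw ↦ hcφ w (hKρ hw))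
      fun w hw ↦ hdF.continuousOn.continuousAt (isOpen_ball.mem_nhds (hKρ hw))
  -- Weierstrass: locally uniform limits of holomorphic maps may be differentiated.
  have hlocd := hloc.deriv ((hf.and hfρ).mono fun n hn ↦
    hdiff (f n) hn.1 fun w hw ↦ (hn.2 w hw).1.2) isOpen_ball
  have hzρ := mem_ball_self (x := z) hρ
  have hcd : ConvergesAt (fun n ↦ deriv (fun w ↦ φ (f n w))) (deriv fun w ↦ φ (F w)) z :=
    TendstoLocallyUniformlyOn.convergesAt isOpen_ball hlocd
      (hdF.deriv isOpen_ball).continuousOn hzρ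
  have hpair : ConvergesAt (fun n w ↦ (φ (f n w), deriv (fun w ↦ φ (f n w)) w))
      (fun w ↦ (φ (F w), deriv (fun w ↦ φ (F w)) w)) z :=
    Tendsto.prodMk_nhds (hcφ z hzρ) hcd
  have hlevi := hpair.comp (φ := fun x ↦ -(1 / (2 * Real.pi)) * leviForm Ψ x.1 x.2)
    ((continuousAt_leviForm (hΨ _ (hFρ z hzρ).2.2) _).const_mul _)
  refine hlevi.congr ?_ (hformula F hF hFρ z hzρ).symm
  filter_upwards [(hf.and hfρ).prod_mk (ball_mem_nhds z hρ)] with p hp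
  exact (hformula (f p.1) hp.1.1 hp.1.2 p.2 hp.2).symm

/-- The preceding convergence applied to a constant sequence. -/
theorem IsHolomorphicOn.continuousOn_chernDensity {L : LineBundle X} (h : HermitianMetric L)
    {f : ℂ → CPoint X} {S : Set ℂ} (hS : IsOpen S) (hf : IsHolomorphicOn f S) :
    ContinuousOn (chernDensity h f) S := fun _ hz ↦
  (convergesAt_chernDensity h hS (Eventually.of_forall fun _ ↦ hf) hf (fun _ hw ↦
    convergesAt_const (hf.1.continuousAt (hS.mem_nhds hw))) hz).continuousAt_of_const
    |>.continuousWithinAt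

end Chern

/-! ### Convergence of characteristic functions. -/

section Characteristic

open Metric Set

/-- The inner integral is a partial integral over `z` of a measurable function of `(t, z)` supported
in `‖z‖ < t`. Extending `D` by zero outside the closed ball makes it measurable everywhere. -/
theorem aestronglyMeasurable_setIntegral_ball {D : ℂ → ℝ} {b : ℝ}
    (hD : ContinuousOn D (closedBall 0 b)) {I : Set ℝ} (hI : MeasurableSet I)
    (hIb : ∀ t ∈ I, t ≤ b) :
    AEStronglyMeasurable (fun t ↦ ∫ z in ball (0 : ℂ) t, D z) (volume.restrict I) := by
  have h1 : AEStronglyMeasurable ((closedBall (0 : ℂ) b).indicator D) volume :=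
    (aestronglyMeasurable_indicator_iff measurableSet_closedBall).2
      (hD.aestronglyMeasurable measurableSet_closedBall)
  have h2 : AEStronglyMeasurable (fun p : ℝ × ℂ ↦ {p : ℝ × ℂ | ‖p.2‖ < p.1}.indicator
      (fun p ↦ (closedBall (0 : ℂ) b).indicator D p.2) p) ((volume.restrict I).prod volume) :=
    (h1.comp_snd).indicator (measurableSet_lt measurable_snd.norm measurable_fst)
  refine h2.integral_prod_right'.congr ?_
  filter_upwards [ae_restrict_mem hI] with t ht
  rw [← integral_indicator measurableSet_ball]
  refine integral_congr_ae (Eventually.of_forall fun z ↦ ?_)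
  by_cases hz : ‖z‖ < t
  · have h3 : z ∈ closedBall (0 : ℂ) b := by simpa using hz.le.trans (hIb t ht)
    simp [indicator, hz, hz.le.trans (hIb t ht)]
  · simp [indicator, hz]

/-- Dominated convergence in `z` and then in `t`; one bound `C` on the compact disc of radius `max 1
r` serves both. -/
theorem tendsto_integral_setIntegral_ball_div {D : ℕ → ℂ → ℝ} {D' : ℂ → ℝ} {ρ : ℝ}
    (hD : ∀ᶠ n in atTop, ContinuousOn (D n) (ball 0 ρ)) (hD' : ContinuousOn D' (ball 0 ρ))
    (hc : ∀ z ∈ ball 0 ρ, ConvergesAt D D' z) {r : ℝ} (hr : 0 < r) (hrρ : r < ρ) (hρ : 1 < ρ) :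
    Tendsto (fun n ↦ ∫ t in (1 : ℝ)..r, (∫ z in ball (0 : ℂ) t, D n z) / t) atTop
      (𝓝 (∫ t in (1 : ℝ)..r, (∫ z in ball (0 : ℂ) t, D' z) / t)) := by
  set b := max 1 r
  have hbρ : b < ρ := max_lt hρ hrρ
  have hsub : closedBall (0 : ℂ) b ⊆ ball 0 ρ := closedBall_subset_ball hbρ
  obtain ⟨C, hC⟩ := exists_eventually_norm_le_of_convergesAt (isCompact_closedBall (0 : ℂ) b)
    (fun z hz ↦ hc z (hsub hz))
    fun z hz ↦ hD'.continuousAt (isOpen_ball.mem_nhds (hsub hz))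
  have hvol : ∀ t, volume (ball (0 : ℂ) t) < ⊤ := fun t ↦ measure_ball_lt_top
  have hball : ∀ t ≤ b, ball (0 : ℂ) t ⊆ closedBall 0 b := fun t ht ↦
    ball_subset_closedBall.trans (closedBall_subset_closedBall ht)
  refine intervalIntegral.tendsto_integral_filter_of_dominated_convergence
    (fun _ ↦ C * volume.real (ball (0 : ℂ) b) / min 1 r) ?_ ?_ intervalIntegrable_const ?_
  · filter_upwards [hD] with n hn
    exact (aestronglyMeasurable_setIntegral_ball (hn.mono hsub) measurableSet_uIoc
      fun t ht ↦ ht.2).div₀ aestronglyMeasurable_id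
  · filter_upwards [hC] with n hn
    refine Eventually.of_forall fun t ht ↦ ?_
    have ht0 : 0 < min 1 r := lt_min one_pos hr
    have ht1 : min 1 r ≤ t := ht.1.le
    have hC0 : 0 ≤ C := (norm_nonneg _).trans (hn 0 (by simp [b]))
    have h1 := norm_setIntegral_le_of_norm_le_const (hvol t) fun z hz ↦ hn z (hball t ht.2 hz)
    have h2 : volume.real (ball (0 : ℂ) t) ≤ volume.real (ball (0 : ℂ) b) :=
      measureReal_mono (ball_subset_ball ht.2) (hvol b).ne
    rw [norm_div, Real.norm_of_nonneg (ht0.le.trans ht1)]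
    have h3 := h1.trans (mul_le_mul_of_nonneg_left h2 hC0)
    gcongr
  · refine Eventually.of_forall fun t ht ↦ Tendsto.div_const ?_ t
    have htb : t ≤ b := ht.2
    refine tendsto_integral_filter_of_dominated_convergence (fun _ ↦ C) ?_ ?_
      (integrableOn_const (hvol t).ne) ?_
    · filter_upwards [hD] with n hn
      exact (hn.mono ((hball t htb).trans hsub)).aestronglyMeasurable measurableSet_ball
    · filter_upwards [hC] with n hn
      filter_upwards [ae_restrict_mem measurableSet_ball] with z hz
      exact hn z (hball t htb hz)
    · filter_upwards [ae_restrict_mem measurableSet_ball] with z hz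
      exact (hc z (hsub (hball t htb hz))).tendsto

variable {X : Scheme.{0}} [X.Over (Spec (CommRingCat.of ℂ))]

theorem tendsto_characteristic {L : LineBundle X} (h : HermitianMetric L)
    {f : ℕ → ℂ → CPoint X} {F : ℂ → CPoint X} {ρ : ℝ}
    (hf : ∀ᶠ n in atTop, IsHolomorphicOn (f n) (ball 0 ρ)) (hF : IsHolomorphicOn F (ball 0 ρ))
    (hc : ∀ z ∈ ball 0 ρ, ConvergesAt f F z) {r : ℝ} (hr : 0 < r) (hrρ : r < ρ) (hρ : 1 < ρ) :
    Tendsto (fun n ↦ characteristic h (f n) r) atTop (𝓝 (characteristic h F r)) :=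
  tendsto_integral_setIntegral_ball_div
    (hf.mono fun _ hn ↦ hn.continuousOn_chernDensity h isOpen_ball)
    (hF.continuousOn_chernDensity h isOpen_ball)
    (fun _ hz ↦ convergesAt_chernDensity h isOpen_ball hf hF hc hz) hr hrρ hρ

end Characteristic

/-! ### Local equations of the divisor of a section. -/

section Divisor

variable {X : Scheme.{0}}

theorem IsDivisorOf.exists_frame {L : LineBundle X} {s : Γ(L.sheaf, ⊤)} {D : X.IdealSheafData}
    (hD : IsDivisorOf L s D) (x : X) : ∃ (U : X.affineOpens) (e : Γ(L.sheaf, U.1))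
      (g : Γ(X, U.1)), x ∈ U.1 ∧ IsFrame L.sheaf e ∧ g • e = res L.sheaf le_top s ∧
        D.ideal U = Ideal.span {g} := by
  obtain ⟨U, e, hx, he⟩ := L.exists_affine_frame x
  obtain ⟨g, hg⟩ := he.exists_smul_eq (res L.sheaf le_top s)
  exact ⟨U, e, g, hx, he, hg, hD U e he g hg⟩

theorem IsDivisorOf.isLocallyPrincipal {L : LineBundle X} {s : Γ(L.sheaf, ⊤)}
    {D : X.IdealSheafData} (hD : IsDivisorOf L s D) : IsLocallyPrincipal D := fun x ↦ by
  obtain ⟨U, -, g, hx, -, -, hg⟩ := hD.exists_frame x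
  exact ⟨U, g, hx, hg⟩

end Divisor

/-! ### Convergence of proximity functions. -/

section Proximity

open Metric

variable {X : Scheme.{0}} [X.Over (Spec (CommRingCat.of ℂ))]

/-- With `s = g • e` locally, `log ‖s‖ = log |g| + log ‖e‖`, and the local equation `g` is nonzero
off `D`. -/
theorem IsDivisorOf.continuousAt_log_norm {L : LineBundle X} (h : HermitianMetric L)
    {s : Γ(L.sheaf, ⊤)} {D : X.IdealSheafData} (hD : IsDivisorOf L s D) {x : CPoint X}
    (hx : x.pt ∉ D.support) : ContinuousAt (fun y ↦ Real.log (h.norm ⊤ s y)) x := by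
  obtain ⟨U, e, g, hU, he, hge, hg⟩ := hD.exists_frame x.pt
  have hgx : evalAt U.1 g x ≠ 0 := by
    intro h0
    refine hx ((pt_mem_support_iff D hU).2 fun a ha ↦ ?_)
    rw [hg, Ideal.mem_span_singleton'] at ha
    obtain ⟨b, rfl⟩ := ha
    rw [evalAt_mul, h0, mul_zero]
  have hcont := continuousAt_evalAt g hU
  refine ((hcont.norm.log (norm_ne_zero_iff.2 hgx)).add
    (h.continuousAt_log_norm_frame he hU)).congr ?_
  filter_upwards [eventually_pt_mem hU, hcont.eventually_ne hgx] with y hy hy0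
  rw [← h.norm_res le_top s y hy, ← hge, h.norm_smul g e y hy,
    Real.log_mul (norm_ne_zero_iff.2 hy0) (h.norm_pos e he y hy).ne']
  rfl

theorem tendsto_proximity {L : LineBundle X} (h : HermitianMetric L) {s : Γ(L.sheaf, ⊤)}
    {D : X.IdealSheafData} (hD : IsDivisorOf L s D) {f : ℕ → ℂ → CPoint X} {F : ℂ → CPoint X}
    {S : Set ℂ} (hS : IsOpen S) (hf : ∀ᶠ n in atTop, IsHolomorphicOn (f n) S)
    (hF : IsHolomorphicOn F S) (hc : ∀ z ∈ S, ConvergesAt f F z) {r : ℝ}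
    (hrS : sphere 0 |r| ⊆ S) (hr : ∀ z ∈ sphere (0 : ℂ) |r|, (F z).pt ∉ D.support) :
    Tendsto (fun n ↦ proximity h s (f n) r) atTop (𝓝 (proximity h s F r)) := by
  have hcont : ∀ v : ℂ → CPoint X, IsHolomorphicOn v S → ∀ z ∈ sphere (0 : ℂ) |r|,
      (v z).pt ∉ D.support → ContinuousAt (fun z ↦ Real.log (h.norm ⊤ s (v z))) z :=
    fun v hv z hz hzD ↦ ContinuousAt.comp (f := v) (hD.continuousAt_log_norm h hzD)
      (hv.1.continuousAt (hS.mem_nhds (hrS hz)))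
  refine (tendsto_circleAverage ?_ (tendstoUniformlyOn_of_convergesAt (isCompact_sphere _ _)
    (fun z hz ↦ (hc z (hrS hz)).comp (hD.continuousAt_log_norm h (hr z hz)))
    fun z hz ↦ hcont F hF z hz (hr z hz))).neg
  filter_upwards [hf, eventually_forall_notMem_support (Z := D) (isCompact_sphere 0 |r|)
    (fun z hz ↦ hc z (hrS hz)) hr] with n hn hnD z hz
  exact (hcont (f n) hn z hz (hnD z hz)).continuousWithinAt

end Proximity

/-! ### Discs of extended radius and the convergence hypothesis. -/

section Convergence

open Metric

theorem isOpen_disc (R : ℝ≥0∞) : IsOpen (disc R) := Metric.isOpen_eball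

theorem mem_disc_iff {z : ℂ} {R : ℝ≥0∞} : z ∈ disc R ↔ ENNReal.ofReal ‖z‖ < R := by
  rw [disc, Metric.mem_eball, edist_zero_right, ofReal_norm]

theorem ball_subset_disc {ρ : ℝ} {R : ℝ≥0∞} (h : ENNReal.ofReal ρ ≤ R) : ball 0 ρ ⊆ disc R :=
  fun z hz ↦ mem_disc_iff.2 <| lt_of_lt_of_le ((ENNReal.ofReal_lt_ofReal_iff_of_nonneg
    (norm_nonneg z)).2 (mem_ball_zero_iff.1 hz)) h

theorem exists_lt_ofReal_lt {m : ℝ} {R : ℝ≥0∞} (h : ENNReal.ofReal m < R) :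
    ∃ ρ, m < ρ ∧ ENNReal.ofReal ρ < R := by
  obtain ⟨c, hmc, hcR⟩ := exists_between h
  have hc : c ≠ ⊤ := (hcR.trans_le le_top).ne
  exact ⟨c.toReal, lt_of_not_ge fun h' ↦ hmc.not_ge
    ((ENNReal.ofReal_toReal hc).symm.trans_le (ENNReal.ofReal_le_ofReal h')),
    by rwa [ENNReal.ofReal_toReal hc]⟩

/-- Uniform convergence on compact sets to a continuous limit implies continuous convergence. -/
theorem convergesAt_of_forall_isCompact {Y : Type*} [t : TopologicalSpace Y] (d : MetricSpace Y)
    (hd : d.toUniformSpace.toTopologicalSpace = t) {f : ℕ → ℂ → Y}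
    {F : ℂ → Y} {S : Set ℂ} (hS : IsOpen S) (hF : ContinuousOn F S)
    (hconv : ∀ K : Set ℂ, IsCompact K → K ⊆ S → ∀ ε : ℝ, 0 < ε →
      ∀ᶠ n in atTop, ∀ z ∈ K, d.dist (f n z) (F z) < ε) {z : ℂ} (hz : z ∈ S) :
    ConvergesAt f F z := by
  subst hd
  refine TendstoLocallyUniformlyOn.convergesAt hS ?_ hF hz
  rw [tendstoLocallyUniformlyOn_iff_forall_isCompact hS]
  intro K hKS hK
  rw [Metric.tendstoUniformlyOn_iff]
  intro ε hε
  filter_upwards [hconv K hK hKS ε hε] with n hn w hw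
  rw [dist_comm]
  exact hn w hw

end Convergence

end Nevanlinna

/-! ### Assembly of the three statements. -/

theorem lemma3p5
    (X : Scheme.{0}) [X.Over (Spec (CommRingCat.of ℂ))] (hX : Nevanlinna.IsProjectiveVariety X)
    (L : Nevanlinna.LineBundle X) (h : Nevanlinna.HermitianMetric L)
    -- a metric on `X(ℂ)` that induces the Euclidean topology
    (d : MetricSpace (Nevanlinna.CPoint X))
    (hd : d.toUniformSpace.toTopologicalSpace = Nevanlinna.euclideanTopology X)
    -- the radii, with limit `Rinf`
    (R : ℕ → ℝ≥0∞) (Rinf : ℝ≥0∞) (hRpos : ∀ n, 0 < R n) (hRmono : Monotone R)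
    (hRlim : Tendsto R atTop (𝓝 Rinf))
    -- the holomorphic maps, converging uniformly on the compact subsets of the limit disc
    (f : ℕ → ℂ → Nevanlinna.CPoint X) (finf : ℂ → Nevanlinna.CPoint X)
    (hf : ∀ n, Nevanlinna.IsHolomorphicOn (f n) (Nevanlinna.disc (R n)))
    (hfinf : Nevanlinna.IsHolomorphicOn finf (Nevanlinna.disc Rinf))
    (hconv : ∀ K : Set ℂ, IsCompact K → K ⊆ Nevanlinna.disc Rinf → ∀ ε : ℝ, 0 < ε →
      ∀ᶠ n in atTop, ∀ z ∈ K, d.dist (f n z) (finf z) < ε)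
    (r : ℝ) (hr : 0 < r) (hrR : ENNReal.ofReal r < Rinf) :
    -- characteristic functions
    (1 < Rinf → Tendsto (fun n ↦ Nevanlinna.characteristic h (f n) r) atTop
      (𝓝 (Nevanlinna.characteristic h finf r))) ∧
    -- proximity and counting functions of a divisor
    (∀ (s : Γ(L.sheaf, ⊤)) (D : X.IdealSheafData), s ≠ 0 → Nevanlinna.IsDivisorOf L s D →
      (∀ z : ℂ, ‖z‖ = r → (finf z).pt ∉ D.support) →
      (∀ᶠ n in atTop, ∃ z ∈ Nevanlinna.disc (R n), (f n z).pt ∉ D.support) ∧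
      Tendsto (fun n ↦ Nevanlinna.proximity h s (f n) r) atTop
        (𝓝 (Nevanlinna.proximity h s finf r)) ∧
      (1 < Rinf → Tendsto (fun n ↦ Nevanlinna.counting D (f n) r) atTop
        (𝓝 (Nevanlinna.counting D finf r)))) ∧
    -- counting functions of a closed subscheme
    (∀ Z : X.IdealSheafData, (∃ z ∈ Nevanlinna.disc Rinf, (finf z).pt ∉ Z.support) → 1 ≤ r →
      ((∀ z : ℂ, ‖z‖ = r → (finf z).pt ∉ Z.support) ∨ ∃ z : ℂ, ‖z‖ < r ∧ (finf z).pt ∈ Z.support) →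
      ∀ᶠ n in atTop, (∃ z ∈ Nevanlinna.disc (R n), (f n z).pt ∉ Z.support) ∧
        Nevanlinna.counting Z (f n) r ≤ 2 * Nevanlinna.counting Z finf r) := by
  have hc : ∀ z ∈ Nevanlinna.disc Rinf, Nevanlinna.ConvergesAt f finf z := fun z hz ↦
    Nevanlinna.convergesAt_of_forall_isCompact d hd (Nevanlinna.isOpen_disc Rinf) hfinf.1 hconv hz
  have hmem : ∀ z ∈ Nevanlinna.disc Rinf, ∀ᶠ n in atTop, z ∈ Nevanlinna.disc (R n) := by
    intro z hz
    filter_upwards [hRlim.eventually_const_lt (Nevanlinna.mem_disc_iff.1 hz)] with n hn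
    exact Nevanlinna.mem_disc_iff.2 hn
  -- A fixed ball on which almost all `f n` are defined, as `ρ` stays strictly below the limit
  -- radius.
  have hball : ∀ m : ℝ, ENNReal.ofReal m < Rinf → ∃ ρ, m < ρ ∧
      Metric.ball 0 ρ ⊆ Nevanlinna.disc Rinf ∧
      ∀ᶠ n in atTop, Nevanlinna.IsHolomorphicOn (f n) (Metric.ball 0 ρ) := by
    intro m hm
    obtain ⟨ρ, hmρ, hρ⟩ := Nevanlinna.exists_lt_ofReal_lt hm
    refine ⟨ρ, hmρ, Nevanlinna.ball_subset_disc hρ.le, ?_⟩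
    filter_upwards [hRlim.eventually_const_lt hρ] with n hn
    exact (hf n).mono (Nevanlinna.ball_subset_disc hn.le)
  have hmax : 1 < Rinf → ENNReal.ofReal (max 1 r) < Rinf := fun h1 ↦ by
    rw [ENNReal.ofReal_max, ENNReal.ofReal_one]
    exact max_lt h1 hrR
  refine ⟨fun h1 ↦ ?_, fun s D _ hD hrD ↦ ?_, fun Z hZ hr1 hrZ ↦ ?_⟩
  · obtain ⟨ρ, hρ, hsub, hfρ⟩ := hball _ (hmax h1)
    obtain ⟨hρ1, hρr⟩ := max_lt_iff.1 hρ
    exact Nevanlinna.tendsto_characteristic h hfρ (hfinf.mono hsub) (fun z hz ↦ hc z (hsub hz))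
      hr hρr hρ1
  · have hnr : ‖(r : ℂ)‖ = r := by simp [hr.le]
    have hrdisc : (r : ℂ) ∈ Nevanlinna.disc Rinf := Nevanlinna.mem_disc_iff.2 (by rwa [hnr])
    refine ⟨?_, ?_, fun h1 ↦ ?_⟩
    · filter_upwards [hmem r hrdisc, Nevanlinna.eventually_forall_notMem_support (Z := D)
        (isCompact_singleton (x := (r : ℂ))) (fun z hz ↦ hc z (hz ▸ hrdisc))
        (fun z hz ↦ hrD z (by rw [hz, hnr]))] with n hn hnD
      exact ⟨r, hn, hnD r rfl⟩
    · obtain ⟨ρ, hρ, hsub, hfρ⟩ := hball r hrR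
      rw [← abs_of_pos hr] at hρ
      exact Nevanlinna.tendsto_proximity h hD Metric.isOpen_ball hfρ (hfinf.mono hsub)
        (fun z hz ↦ hc z (hsub hz)) (Metric.sphere_subset_closedBall.trans
          (Metric.closedBall_subset_ball hρ))
        fun z hz ↦ hrD z (by rwa [mem_sphere_zero_iff_norm, abs_of_pos hr] at hz)
    · obtain ⟨ρ, hρ, hsub, hfρ⟩ := hball _ (hmax h1)
      obtain ⟨hρ1, hρr⟩ := max_lt_iff.1 hρ
      have hF := hfinf.mono hsub
      exact Nevanlinna.tendsto_counting hfρ hF (fun z hz ↦ hc z (hsub hz))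
        hD.isLocallyPrincipal (fun z hz ↦ hF.orderAt_ne_top Metric.isOpen_ball
          (convex_ball 0 ρ).isPreconnected
          ⟨r, mem_ball_zero_iff.2 (by rwa [hnr]), hrD r hnr⟩ hz) hr hρr hρ1
  · obtain ⟨z₀, hz₀, hz₀Z⟩ := hZ
    -- The ball must contain `z₀`, which may lie outside the disc of radius `r`: it is the point
    -- that makes all contact orders finite.
    obtain ⟨ρ, hρ, hsub, hfρ⟩ := hball (max r ‖z₀‖) (by
      rw [ENNReal.ofReal_max]
      exact max_lt hrR (Nevanlinna.mem_disc_iff.1 hz₀))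
    obtain ⟨hρr, hρz⟩ := max_lt_iff.1 hρ
    have hF := hfinf.mono hsub
    filter_upwards [hmem z₀ hz₀, Nevanlinna.eventually_forall_notMem_support (Z := Z)
        (isCompact_singleton (x := z₀)) (fun z hz ↦ hc z (hz ▸ hz₀))
        (fun z hz ↦ by rwa [hz]), Nevanlinna.eventually_counting_le_two_mul hfρ hF
        (fun z hz ↦ hc z (hsub hz)) (fun z hz ↦ hF.orderAt_ne_top Metric.isOpen_ball
          (convex_ball 0 ρ).isPreconnected ⟨z₀, mem_ball_zero_iff.2 hρz, hz₀Z⟩ hz)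
        hr1 hρr hrZ] with n hn hnZ hcount
    exact ⟨⟨z₀, hn, hnZ z₀ rfl⟩, hcount⟩
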